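/- Let $(M,g_M)$ be a Riemannian manifold and $(N,g_N,P)$ a Kähler manifold: $P$ is a smooth $(1,1)$-tensor with $P^2=-I$, $g_N(PX,PY)=g_N(X,Y)$ and $\nabla^N P=0$, where $\nabla^N$ is the Levi-Civita connection. Let $F:M\to N$ be smooth, $\ker F_*\subseteq TM$ and $\operatorname{range}F_*\subseteq F^{-1}TN$ the kernel and range of its differential, and $\nabla^N_X$ also the pullback connection on sections of $F^{-1}TN$. Assume that $F$ is a Clairaut semi-invariant Riemannian map with $s=e^f$, where $f:N\to\mathbb R$ is smooth; that is: * (Riemannian map) $g_N(F_*X,F_*Y)=g_M(X,Y)$ for all $X,Y\in(\ker F_*)^\perp$; * (semi-invariant) $\operatorname{range}F_*=D_1\oplus D_2$ with mutually orthogonal smooth subbundles $D_1,D_2$ such that $P(D_1)=D_1$ and $P(D_2)\subseteq(\operatorname{range}F_*)^\perp$; * (Clairaut) for every geodesic $\beta$ of $N$ the function $(s\circ\beta)\sin\theta$ is constant on the set of all $t$ with $\beta(t)\in F(M)$, where $\theta(t)$ is the angle between $\dot\beta(t)$ and its component in $(\operatorname{range}F_{*q})^\perp$, $F(q)=\beta(t)$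 (with $\theta=\pi/2$ if this component is $0$; the value must not depend on the choice of $q$). For $v\in\operatorname{range}F_*$ write $Pv=\phi v+\omega v$ with $\phi v\in D_1$, $\omega v\in P(D_2)$. For $V\in(\operatorname{range}F_*)^\perp$ write $PV=BV+CV$ with $BV\in D_2$ and $CV\in\eta$, where $\eta$ is the orthogonal complement of $P(D_2)$ in $(\operatorname{range}F_*)^\perp$. For $X\in\Gamma(TM)$ and a section $V$ of $(\operatorname{range}F_*)^\perp$ write $\nabla^N_XV=-S_VF_*X+\nabla^{F\perp}_XV$ with $S_VF_*X\in\operatorname{range}F_*$ and $\nabla^{F\perp}_XV\in(\operatorname{range}F_*)^\perp$. Suppose moreover that $\ker F_*$ is minimal, i.e. $\sum_i(\nabla^M_{U_i}U_i)^{(\ker F_*)^\perp}=0$ for local orthonormal frames $(U_i)$ of $\ker F_*$. Then $F$ is harmonic, i.e. the trace of its second fundamental form $(\nabla F_*)(X,Y)=\nabla^N_XF_*Y-F_*(\nabla^M_XY)$ vanishes, if and only if $$\operatorname{trace}\left\{\omega S_{\omega F_*X}F_*X-C\nabla^{F\perp}_X\omega F_*X-\left(\nabla^N_XP\phi F_*X\right)^{(\operatorname{range}F_*)^\perp}\right\}=0,$$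 where $X\in\Gamma((\ker F_*)^\perp)$ and the trace is taken over $(\ker F_*)^\perp$, at every point of $M$. -/

import Mathlib

open Bundle Manifold Set Filter
open scoped ContDiff Topology

namespace ClairautMap

noncomputable section

/-! ### The Levi-Civita connection and its pullback along a map -/

section Connection

variable {E : Type*} [NormedAddCommGroup E] [NormedSpace ℝ E] [FiniteDimensional ℝ E]
  {N : Type*} [TopologicalSpace N] [ChartedSpace E N] [IsManifold 𝓘(ℝ, E) ∞ N]
  {E' : Type*} [NormedAddCommGroup E'] [NormedSpace ℝ E']
  {A : Type*} [TopologicalSpace A] [ChartedSpace E' A]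

instance instFiniteDimensionalTangentSpace (y : N) :
    FiniteDimensional ℝ (TangentSpace 𝓘(ℝ, E) y) :=
  inferInstanceAs (FiniteDimensional ℝ E)

variable [RiemannianBundle (fun y : N ↦ TangentSpace 𝓘(ℝ, E) y)]

/-- For tangent vectors `u v` at `y`, extended to vector fields `U V` with constant coefficients in
the chart at `y`, and `w` tangent at `y`: the derivative at `y` of `g(U, V)` in the direction
`w`. -/
def metricDeriv (y : N) (u v w : TangentSpace 𝓘(ℝ, E) y) : ℝ :=
  mvfderiv 𝓘(ℝ, E)
    (fun y' : N ↦ inner ℝ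
      (FiberBundle.extend E u y' : TangentSpace 𝓘(ℝ, E) y')
      (FiberBundle.extend E v y' : TangentSpace 𝓘(ℝ, E) y')) y w

/-- The Christoffel symbols at `y`, in the chart at `y`: the vector `Γ(u, v)` with
`g(Γ(u, v), w) = (∂ᵤ g(v, w) + ∂ᵥ g(u, w) - ∂_w g(u, v)) / 2` for all `w`. -/
def christoffel (y : N) (u v : TangentSpace 𝓘(ℝ, E) y) : TangentSpace 𝓘(ℝ, E) y :=
  ∑ i, ((metricDeriv y v (stdOrthonormalBasis ℝ (TangentSpace 𝓘(ℝ, E) y) i) u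
      + metricDeriv y u (stdOrthonormalBasis ℝ (TangentSpace 𝓘(ℝ, E) y) i) v
      - metricDeriv y u v (stdOrthonormalBasis ℝ (TangentSpace 𝓘(ℝ, E) y) i)) / 2) •
    stdOrthonormalBasis ℝ (TangentSpace 𝓘(ℝ, E) y) i

/-- The pullback `∇^F` of the Levi-Civita connection of `N` along `F : A → N`, applied to a section
`σ` of `F⁻¹TN` and a tangent vector `x` at `q`. In the chart of `N` at `F q` it is
`dσ(x) + Γ(F_* x, σ)`. -/
def pullbackCov (F : A → N) (σ : ∀ q, TangentSpace 𝓘(ℝ, E) (F q)) (q : A)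
    (x : TangentSpace 𝓘(ℝ, E') q) : TangentSpace 𝓘(ℝ, E) (F q) :=
  (trivializationAt E (TangentSpace 𝓘(ℝ, E)) (F q)).symm (F q)
      (mvfderiv 𝓘(ℝ, E')
        (fun q' : A ↦ ((trivializationAt E (TangentSpace 𝓘(ℝ, E)) (F q))
          (⟨F q', σ q'⟩ : TangentBundle 𝓘(ℝ, E) N)).2) q x)
    + christoffel (F q) (mfderiv 𝓘(ℝ, E') 𝓘(ℝ, E) F q x) (σ q)

/-- The Levi-Civita connection: `leviCivita Y y x` is `∇_x Y` at the point `y`. -/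
def leviCivita (Y : ∀ y : N, TangentSpace 𝓘(ℝ, E) y) (y : N) (x : TangentSpace 𝓘(ℝ, E) y) :
    TangentSpace 𝓘(ℝ, E) y :=
  pullbackCov (fun p : N ↦ p) Y y x

variable (E) in
/-- The velocity of a curve, as a section along the curve. -/
def velocity (β : ℝ → N) (t : ℝ) : TangentSpace 𝓘(ℝ, E) (β t) :=
  mfderiv 𝓘(ℝ, ℝ) 𝓘(ℝ, E) β t ((NormedSpace.fromTangentSpace t).symm (1 : ℝ))

variable (E) in
/-- `β` restricted to the open interval `J` is a geodesic of `N`. -/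
def IsGeodesicOn (β : ℝ → N) (J : Set ℝ) : Prop :=
  IsOpen J ∧ J.OrdConnected ∧ ContMDiffOn 𝓘(ℝ, ℝ) 𝓘(ℝ, E) ∞ β J ∧
    ∀ t ∈ J, pullbackCov β (velocity E β) t ((NormedSpace.fromTangentSpace t).symm (1 : ℝ)) = 0

/-- An (integrable) complex structure making the Riemannian manifold `N` a Kähler manifold: a
smooth tensor `P` of type `(1, 1)` with `P² = -1`, `g(PX, PY) = g(X, Y)` and `∇P = 0`. -/
structure IsKahler (P : ∀ y : N, TangentSpace 𝓘(ℝ, E) y →L[ℝ] TangentSpace 𝓘(ℝ, E) y) :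
    Prop where
  smooth : ContMDiff 𝓘(ℝ, E) (𝓘(ℝ, E).prod 𝓘(ℝ, E →L[ℝ] E)) ∞
    (fun y : N ↦ TotalSpace.mk' (E →L[ℝ] E)
      (E := fun y : N ↦ TangentSpace 𝓘(ℝ, E) y →L[ℝ] TangentSpace 𝓘(ℝ, E) y) y (P y))
  sq : ∀ y v, P y (P y v) = -v
  isometry : ∀ (y : N) (v w : TangentSpace 𝓘(ℝ, E) y), inner ℝ (P y v) (P y w) = inner ℝ v w
  parallel : ∀ (Y : ∀ y : N, TangentSpace 𝓘(ℝ, E) y) (y : N) (x : TangentSpace 𝓘(ℝ, E) y),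
    ContMDiffAt 𝓘(ℝ, E) 𝓘(ℝ, E).tangent ∞ (fun p ↦ (⟨p, Y p⟩ : TangentBundle 𝓘(ℝ, E) N)) y →
    leviCivita (fun p ↦ P p (Y p)) y x = P y (leviCivita Y y x)

/-! ### Traces over distributions -/

/-- Vector fields `e i`, smooth at `q`, tangent to the distribution `D` near `q`, and orthonormal
at `q`. -/
structure IsFrameAt (D : ∀ q : N, Submodule ℝ (TangentSpace 𝓘(ℝ, E) q)) (q : N) {ι : Type*}
    (e : ι → ∀ p : N, TangentSpace 𝓘(ℝ, E) p) : Prop where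
  smooth : ∀ i, ContMDiffAt 𝓘(ℝ, E) 𝓘(ℝ, E).tangent ∞
    (fun p ↦ (⟨p, e i p⟩ : TangentBundle 𝓘(ℝ, E) N)) q
  mem : ∀ i, ∀ᶠ p in 𝓝 q, e i p ∈ D p
  orthonormal : Orthonormal ℝ (fun i ↦ e i q)

/-- The trace over the distribution `D` of an expression `Q X`, quadratic in the section `X` of
`D`, vanishes: `∑ Q(eᵢ) = 0` at every point `q` and for all sections `e₁, …, e_k` of `D` near `q`
that form an orthonormal basis of `D q` at `q`. -/
def TraceVanishes (D : ∀ q : N, Submodule ℝ (TangentSpace 𝓘(ℝ, E) q)) {B : N → Type*}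
    [∀ q, AddCommGroup (B q)] (Q : (∀ p : N, TangentSpace 𝓘(ℝ, E) p) → ∀ q, B q) : Prop :=
  ∀ (q : N) (e : Fin (Module.finrank ℝ (D q)) → ∀ p : N, TangentSpace 𝓘(ℝ, E) p),
    IsFrameAt D q e → ∑ i, Q (e i) q = 0

end Connection

/-! ### Riemannian maps -/

section Maps

variable {EM : Type*} [NormedAddCommGroup EM] [NormedSpace ℝ EM] [FiniteDimensional ℝ EM]
  {M : Type*} [TopologicalSpace M] [ChartedSpace EM M] [IsManifold 𝓘(ℝ, EM) ∞ M]
  [RiemannianBundle (fun q : M ↦ TangentSpace 𝓘(ℝ, EM) q)]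
  {EN : Type*} [NormedAddCommGroup EN] [NormedSpace ℝ EN] [FiniteDimensional ℝ EN]
  {N : Type*} [TopologicalSpace N] [ChartedSpace EN N] [IsManifold 𝓘(ℝ, EN) ∞ N]
  [RiemannianBundle (fun y : N ↦ TangentSpace 𝓘(ℝ, EN) y)]

variable (EM EN) in
/-- `ker F_*`. -/
def vert (F : M → N) (q : M) : Submodule ℝ (TangentSpace 𝓘(ℝ, EM) q) :=
  LinearMap.ker (mfderiv 𝓘(ℝ, EM) 𝓘(ℝ, EN) F q).toLinearMap

variable (EM EN) in
/-- `(ker F_*)^⊥`. -/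
def horiz (F : M → N) (q : M) : Submodule ℝ (TangentSpace 𝓘(ℝ, EM) q) :=
  (vert EM EN F q)ᗮ

variable (EM EN) in
/-- `range F_*`, as a subbundle of `F⁻¹TN`. -/
def rangeD (F : M → N) (q : M) : Submodule ℝ (TangentSpace 𝓘(ℝ, EN) (F q)) :=
  LinearMap.range (mfderiv 𝓘(ℝ, EM) 𝓘(ℝ, EN) F q).toLinearMap

variable (EN) in
/-- `F_* X`, as a section of `F⁻¹TN`. -/
def push (F : M → N) (X : ∀ q : M, TangentSpace 𝓘(ℝ, EM) q) (q : M) :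
    TangentSpace 𝓘(ℝ, EN) (F q) :=
  mfderiv 𝓘(ℝ, EM) 𝓘(ℝ, EN) F q (X q)

variable (EM) in
/-- The orthogonal projection of `T_{F q} N` onto `(range F_{*q})^⊥`. -/
def normalPart (F : M → N) (q : M) (v : TangentSpace 𝓘(ℝ, EN) (F q)) :
    TangentSpace 𝓘(ℝ, EN) (F q) :=
  (rangeD EM EN F q)ᗮ.starProjection v

variable (EN) in
/-- The second fundamental form `(∇F_*)(X, Y) = ∇^F_X F_* Y - F_*(∇_X Y)`. -/
def secondFundamentalForm (F : M → N) (X Y : ∀ q : M, TangentSpace 𝓘(ℝ, EM) q) (q : M) :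
    TangentSpace 𝓘(ℝ, EN) (F q) :=
  pullbackCov F (push EN F Y) q (X q) - mfderiv 𝓘(ℝ, EM) 𝓘(ℝ, EN) F q (leviCivita Y q (X q))

variable (EM EN) in
/-- `F` is harmonic: its tension field `trace ∇F_*` vanishes. -/
def IsHarmonic (F : M → N) : Prop :=
  TraceVanishes (fun q : M ↦ (⊤ : Submodule ℝ (TangentSpace 𝓘(ℝ, EM) q)))
    (fun X ↦ secondFundamentalForm EN F X X)

variable (EM EN) in
/-- `ker F_*` (equivalently, the fibres of `F`) is minimal: the trace of its second fundamental form
`(U, W) ↦ (∇_U W)^{(ker F_*)^⊥}` vanishes. -/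
def HasMinimalKer (F : M → N) : Prop :=
  TraceVanishes (vert EM EN F)
    (fun U q ↦ (horiz EM EN F q).starProjection (leviCivita U q (U q)))

variable (EM EN) in
/-- `F` is a Riemannian map: smooth, and `F_*` is isometric on `(ker F_*)^⊥`. -/
structure IsRiemannianMap (F : M → N) : Prop where
  smooth : ContMDiff 𝓘(ℝ, EM) 𝓘(ℝ, EN) ∞ F
  isometry : ∀ (q : M), ∀ x ∈ horiz EM EN F q, ∀ y ∈ horiz EM EN F q,
    inner ℝ (mfderiv 𝓘(ℝ, EM) 𝓘(ℝ, EN) F q x) (mfderiv 𝓘(ℝ, EM) 𝓘(ℝ, EN) F q y) = inner ℝ x y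

variable (EM) in
/-- `sin θ`, where `θ` is the angle between a vector `v` tangent to `N` at `F q` and the component
of `v` in `(range F_{*q})^⊥`. If this component is zero then `θ = π / 2`. -/
def sinAngle (F : M → N) (q : M) (v : TangentSpace 𝓘(ℝ, EN) (F q)) : ℝ :=
  Real.sin (InnerProductGeometry.angle v (normalPart EM F q v))

variable (EM EN) in
/-- The Clairaut condition with the function `s : N → (0, ∞)`: along every geodesic `β` of `N`, the
function `(s ∘ β) sin θ` is constant. The splitting of `β'(t)` along `range F_*` and
`(range F_*)^⊥`, and hence the angle `θ(t)`, makes sense whenever `β(t) = F q` for some `q`. -/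
structure IsClairaut (F : M → N) (s : N → ℝ) : Prop where
  pos : ∀ y, 0 < s y
  const : ∀ (β : ℝ → N) (J : Set ℝ), IsGeodesicOn EN β J →
    ∀ t₁ ∈ J, ∀ t₂ ∈ J, ∀ (q₁ q₂ : M)
      (v₁ : TangentSpace 𝓘(ℝ, EN) (F q₁)) (v₂ : TangentSpace 𝓘(ℝ, EN) (F q₂)),
      (⟨F q₁, v₁⟩ : TangentBundle 𝓘(ℝ, EN) N) = ⟨β t₁, velocity EN β t₁⟩ →
      (⟨F q₂, v₂⟩ : TangentBundle 𝓘(ℝ, EN) N) = ⟨β t₂, velocity EN β t₂⟩ →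
      s (F q₁) * sinAngle EM F q₁ v₁ = s (F q₂) * sinAngle EM F q₂ v₂

variable (EM) in
/-- A smooth subbundle of `F⁻¹TN`: near every point it has a frame of smooth sections. -/
def IsSmoothSubbundle (F : M → N) (D : ∀ q : M, Submodule ℝ (TangentSpace 𝓘(ℝ, EN) (F q))) :
    Prop :=
  ∀ q₀ : M, ∃ (U : Set M) (k : ℕ) (σ : Fin k → ∀ q : M, TangentSpace 𝓘(ℝ, EN) (F q)),
    IsOpen U ∧ q₀ ∈ U ∧
    (∀ i, ContMDiffOn 𝓘(ℝ, EM) 𝓘(ℝ, EN).tangent ∞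
      (fun q ↦ (⟨F q, σ i q⟩ : TangentBundle 𝓘(ℝ, EN) N)) U) ∧
    ∀ q ∈ U, LinearIndependent ℝ (fun i ↦ σ i q) ∧
      Submodule.span ℝ (Set.range (fun i ↦ σ i q)) = D q

variable (F : M → N) (P : ∀ y : N, TangentSpace 𝓘(ℝ, EN) y →L[ℝ] TangentSpace 𝓘(ℝ, EN) y)
  (D₁ D₂ : ∀ q : M, Submodule ℝ (TangentSpace 𝓘(ℝ, EN) (F q)))

/-- The subspace `P(D)` of `T_{F q} N`. -/
def imP (D : ∀ q : M, Submodule ℝ (TangentSpace 𝓘(ℝ, EN) (F q))) (q : M) :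
    Submodule ℝ (TangentSpace 𝓘(ℝ, EN) (F q)) :=
  (D q).map (P (F q)).toLinearMap

variable (EM) in
/-- `F` is a semi-invariant Riemannian map, with `range F_* = D₁ ⊕ D₂`, `P(D₁) = D₁` and
`P(D₂) ⊆ (range F_*)^⊥`. -/
structure IsSemiInvariant : Prop extends IsRiemannianMap EM EN F where
  subbundle₁ : IsSmoothSubbundle EM F D₁
  subbundle₂ : IsSmoothSubbundle EM F D₂
  sup_eq : ∀ q, D₁ q ⊔ D₂ q = rangeD EM EN F q
  orthogonal : ∀ q, D₁ q ⟂ D₂ q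
  map_eq : ∀ q, imP F P D₁ q = D₁ q
  map_le : ∀ q, imP F P D₂ q ≤ (rangeD EM EN F q)ᗮ

variable (EM) in
/-- A Clairaut semi-invariant Riemannian map with `s = e^f`. -/
structure IsCSIRM (f : N → ℝ) : Prop extends IsSemiInvariant EM F P D₁ D₂ where
  smooth_f : ContMDiff 𝓘(ℝ, EN) 𝓘(ℝ, ℝ) ∞ f
  clairaut : IsClairaut EM EN F (fun y ↦ Real.exp (f y))

variable (EM) in
/-- The complement `η` of `P(D₂)` in `(range F_*)^⊥`. -/
def eta (q : M) : Submodule ℝ (TangentSpace 𝓘(ℝ, EN) (F q)) :=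
  (rangeD EM EN F q)ᗮ ⊓ (imP F P D₂ q)ᗮ

/-- The `D₁`-component `φ` of `P`, in the splitting `P v = φ v + ω v` of `P` on `range F_*`. -/
def phi (σ : ∀ q : M, TangentSpace 𝓘(ℝ, EN) (F q)) (q : M) : TangentSpace 𝓘(ℝ, EN) (F q) :=
  (D₁ q).starProjection (P (F q) (σ q))

/-- The `P(D₂)`-component `ω` of `P`, in the splitting `P v = φ v + ω v` of `P` on `range F_*`. -/
def omega (σ : ∀ q : M, TangentSpace 𝓘(ℝ, EN) (F q)) (q : M) : TangentSpace 𝓘(ℝ, EN) (F q) :=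
  (imP F P D₂ q).starProjection (P (F q) (σ q))

variable (EM) in
/-- The `η`-component `C` of `P`, in the splitting `P V = B V + C V` of `P` on
`(range F_*)^⊥`. -/
def cPart (σ : ∀ q : M, TangentSpace 𝓘(ℝ, EN) (F q)) (q : M) : TangentSpace 𝓘(ℝ, EN) (F q) :=
  (eta EM F P D₂ q).starProjection (P (F q) (σ q))

/-- `S_V F_* X`, minus the component in `range F_*` of `∇^F_X V`. -/
def shape (V : ∀ q : M, TangentSpace 𝓘(ℝ, EN) (F q)) (X : ∀ q : M, TangentSpace 𝓘(ℝ, EM) q)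
    (q : M) : TangentSpace 𝓘(ℝ, EN) (F q) :=
  -(rangeD EM EN F q).starProjection (pullbackCov F V q (X q))

/-- `∇^{F⊥}_X V`, the component in `(range F_*)^⊥` of `∇^F_X V`. -/
def normalCov (X : ∀ q : M, TangentSpace 𝓘(ℝ, EM) q) (V : ∀ q : M, TangentSpace 𝓘(ℝ, EN) (F q))
    (q : M) : TangentSpace 𝓘(ℝ, EN) (F q) :=
  normalPart EM F q (pullbackCov F V q (X q))

/-- `ω S_{ω F_* X} F_* X - C ∇^{F⊥}_X ω F_* X - (∇^F_X P φ F_* X)^{(range F_*)^⊥}`. -/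
def harmonicityTerm (X : ∀ q : M, TangentSpace 𝓘(ℝ, EM) q) (q : M) :
    TangentSpace 𝓘(ℝ, EN) (F q) :=
  omega F P D₂ (shape F (omega F P D₂ (push EN F X)) X) q
    - cPart EM F P D₂ (normalCov F X (omega F P D₂ (push EN F X))) q
    - normalPart EM F q
        (pullbackCov F (fun p ↦ P (F p) (phi F P D₁ (push EN F X) p)) q (X q))

end Maps

end

end ClairautMap

/-! For horizontal `X` the harmonicity term is exactly `(∇F_*)(X, X)`. Two facts give this.

First, `P` is parallel along `F` and `P² = -1`, so `∇_X F_*X = -P ∇_X (P F_*X) = -P ∇_X φF_*X - P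
∇_X ωF_*X`. In the normal part, the first summand is `-(∇_X PφF_*X)^⊥`. In the second, `∇_X ωF_*X =
-S + ∇^⊥`, where the normal part of `P` is `ω` on the range and `C` on its complement; this gives
`ωS - C∇^⊥`. The term `F_*(∇_X X)` of `(∇F_*)(X, X)` is tangent to the range and drops out
(`harmonicityTerm_eq_normalPart`).

Second, for a Riemannian map `∇F_*` restricted to `(ker F_*)^⊥` is already normal
(`hessian_mem_orthogonal`): the form `g_N((∇F_*)(x, y), F_*z)` is symmetric in `x, y` and skew in
`y, z`.

The trace of `∇F_*` splits over `(ker F_*)^⊥` and `ker F_*`. On the kernel `(∇F_*)(U, U) = -F_*(∇_U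
U)`, whose trace vanishes by minimality (`HasMinimalKer.sum_hessian_eq`). Hence the two traces agree
at every point.

The connection is given by Christoffel symbols in the chart at each point, so its properties have to
be derived: compatibility with the metric, Leibniz rules, `∇P = 0` along `F`, tensoriality and
symmetry of `∇F_*`. The main device is `SmoothAlongAt.induction`, which reduces such claims to
sections with constant coefficients in a chart. Projected sections are shown to be smooth by
inverting Gram matrices (`SmoothAlongAt.of_inner`). -/

namespace ClairautMap

/-! ### Smooth sections along a map. -/

section SectionsAlong

variable {E : Type*} [NormedAddCommGroup E] [NormedSpace ℝ E]
  {N : Type*} [TopologicalSpace N] [ChartedSpace E N] [IsManifold 𝓘(ℝ, E) ∞ N]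
  {A : Type*}

/-- A section of `F⁻¹TN` in the chart of `N` at `y`. -/
noncomputable def coordAlong (F : A → N) (y : N) (σ : ∀ q, TangentSpace 𝓘(ℝ, E) (F q)) (q : A) :
    E :=
  ((trivializationAt E (TangentSpace 𝓘(ℝ, E)) y) (⟨F q, σ q⟩ : TangentBundle 𝓘(ℝ, E) N)).2

variable {F : A → N} {q : A} {σ τ : ∀ q, TangentSpace 𝓘(ℝ, E) (F q)}

theorem coordAlong_add {y : N} {q' : A}
    (h : F q' ∈ (trivializationAt E (TangentSpace 𝓘(ℝ, E)) y).baseSet) :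
    coordAlong F y (fun p ↦ σ p + τ p) q' = coordAlong F y σ q' + coordAlong F y τ q' :=
  ((trivializationAt E (TangentSpace 𝓘(ℝ, E)) y).linear ℝ h).1 _ _

theorem coordAlong_smul {y : N} {q' : A} {a : A → ℝ}
    (h : F q' ∈ (trivializationAt E (TangentSpace 𝓘(ℝ, E)) y).baseSet) :
    coordAlong F y (fun p ↦ a p • σ p) q' = a q' • coordAlong F y σ q' :=
  ((trivializationAt E (TangentSpace 𝓘(ℝ, E)) y).linear ℝ h).2 _ _

theorem symm_coordAlong {y : N} {q' : A}
    (h : F q' ∈ (trivializationAt E (TangentSpace 𝓘(ℝ, E)) y).baseSet) :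
    (trivializationAt E (TangentSpace 𝓘(ℝ, E)) y).symm (F q') (coordAlong F y σ q') = σ q' :=
  (trivializationAt E (TangentSpace 𝓘(ℝ, E)) y).symm_apply_apply_mk h _

theorem coordAlong_extend (y : N) (u : TangentSpace 𝓘(ℝ, E) y) {q' : A}
    (h : F q' ∈ (trivializationAt E (TangentSpace 𝓘(ℝ, E)) y).baseSet) :
    coordAlong F y (fun p ↦ FiberBundle.extend E u (F p)) q'
      = ((trivializationAt E (TangentSpace 𝓘(ℝ, E)) y)
        (⟨y, u⟩ : TangentBundle 𝓘(ℝ, E) N)).2 := by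
  simp only [coordAlong, FiberBundle.extend]
  rw [(trivializationAt E (TangentSpace 𝓘(ℝ, E)) y).apply_mk_symm h]

variable {E' : Type*} [NormedAddCommGroup E'] [NormedSpace ℝ E']
  [TopologicalSpace A] [ChartedSpace E' A]

variable (E') in
/-- Smoothness at `q` of a section `σ` of `F⁻¹TN`. -/
def SmoothAlongAt (F : A → N) (σ : ∀ q, TangentSpace 𝓘(ℝ, E) (F q)) (q : A) : Prop :=
  ContMDiffAt 𝓘(ℝ, E') 𝓘(ℝ, E).tangent ∞
    (fun q' : A ↦ (⟨F q', σ q'⟩ : TangentBundle 𝓘(ℝ, E) N)) q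

theorem smoothAlongAt_iff :
    SmoothAlongAt E' F σ q ↔ ContMDiffAt 𝓘(ℝ, E') 𝓘(ℝ, E) ∞ F q ∧
      ContMDiffAt 𝓘(ℝ, E') 𝓘(ℝ, E) ∞ (coordAlong F (F q) σ) q :=
  contMDiffAt_totalSpace

theorem eventually_mem_baseSet (hF : ContinuousAt F q) :
    ∀ᶠ q' in 𝓝 q, F q' ∈ (trivializationAt E (TangentSpace 𝓘(ℝ, E)) (F q)).baseSet :=
  hF.eventually ((trivializationAt E (TangentSpace 𝓘(ℝ, E)) (F q)).open_baseSet.mem_nhds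
    (FiberBundle.mem_baseSet_trivializationAt' (F q)))

namespace SmoothAlongAt

theorem contMDiffAt (h : SmoothAlongAt E' F σ q) : ContMDiffAt 𝓘(ℝ, E') 𝓘(ℝ, E) ∞ F q :=
  (smoothAlongAt_iff.1 h).1

theorem coord (h : SmoothAlongAt E' F σ q) :
    ContMDiffAt 𝓘(ℝ, E') 𝓘(ℝ, E) ∞ (coordAlong F (F q) σ) q :=
  (smoothAlongAt_iff.1 h).2

theorem congr (h : SmoothAlongAt E' F σ q) (hστ : ∀ᶠ p in 𝓝 q, σ p = τ p) :
    SmoothAlongAt E' F τ q :=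
  ContMDiffAt.congr_of_eventuallyEq h (hστ.mono fun p hp ↦ by simp only [hp])

theorem add (hσ : SmoothAlongAt E' F σ q) (hτ : SmoothAlongAt E' F τ q) :
    SmoothAlongAt E' F (fun p ↦ σ p + τ p) q :=
  smoothAlongAt_iff.2 ⟨hσ.contMDiffAt, (hσ.coord.add hτ.coord).congr_of_eventuallyEq
    ((eventually_mem_baseSet (E := E) hσ.contMDiffAt.continuousAt).mono
      fun _ hp ↦ coordAlong_add hp)⟩

theorem smul {a : A → ℝ} (ha : ContMDiffAt 𝓘(ℝ, E') 𝓘(ℝ, ℝ) ∞ a q) (hσ : SmoothAlongAt E' F σ q) :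
    SmoothAlongAt E' F (fun p ↦ a p • σ p) q :=
  smoothAlongAt_iff.2 ⟨hσ.contMDiffAt, (ha.smul hσ.coord).congr_of_eventuallyEq
    ((eventually_mem_baseSet (E := E) hσ.contMDiffAt.continuousAt).mono
      fun _ hp ↦ coordAlong_smul hp)⟩

theorem neg (hσ : SmoothAlongAt E' F σ q) : SmoothAlongAt E' F (fun p ↦ -σ p) q :=
  (hσ.smul (a := fun _ ↦ (-1 : ℝ)) contMDiffAt_const).congr (.of_forall fun p ↦ by simp)

theorem sub (hσ : SmoothAlongAt E' F σ q) (hτ : SmoothAlongAt E' F τ q) :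
    SmoothAlongAt E' F (fun p ↦ σ p - τ p) q :=
  (hσ.add hτ.neg).congr (.of_forall fun p ↦ by simp [sub_eq_add_neg])

theorem extend_comp (hF : ContMDiffAt 𝓘(ℝ, E') 𝓘(ℝ, E) ∞ F q) (u : TangentSpace 𝓘(ℝ, E) (F q)) :
    SmoothAlongAt E' F (fun p ↦ FiberBundle.extend E u (F p)) q :=
  smoothAlongAt_iff.2 ⟨hF, contMDiffAt_const.congr_of_eventuallyEq
    ((eventually_mem_baseSet (E := E) hF.continuousAt).mono fun _ hp ↦ coordAlong_extend _ u hp)⟩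

theorem zero (hF : ContMDiffAt 𝓘(ℝ, E') 𝓘(ℝ, E) ∞ F q) :
    SmoothAlongAt E' F (fun p ↦ (0 : TangentSpace 𝓘(ℝ, E) (F p))) q :=
  ((extend_comp hF 0).smul (a := fun _ ↦ (0 : ℝ)) contMDiffAt_const).congr
    (.of_forall fun p ↦ by simp)

theorem sum (hF : ContMDiffAt 𝓘(ℝ, E') 𝓘(ℝ, E) ∞ F q) {ι : Type*} (s : Finset ι)
    {ρ : ι → ∀ q, TangentSpace 𝓘(ℝ, E) (F q)} (h : ∀ i ∈ s, SmoothAlongAt E' F (ρ i) q) :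
    SmoothAlongAt E' F (fun p ↦ ∑ i ∈ s, ρ i p) q := by
  classical
  induction s using Finset.induction_on with
  | empty => simpa using zero hF
  | insert i s hi ih =>
    simp only [Finset.sum_insert hi]
    exact (h i (s.mem_insert_self i)).add (ih fun j hj ↦ h j (Finset.mem_insert_of_mem hj))

theorem comp {Y : ∀ y : N, TangentSpace 𝓘(ℝ, E) y}
    (hY : SmoothAlongAt E (fun y : N ↦ y) Y (F q)) (hF : ContMDiffAt 𝓘(ℝ, E') 𝓘(ℝ, E) ∞ F q) :
    SmoothAlongAt E' F (fun p ↦ Y (F p)) q :=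
  ContMDiffAt.comp q hY hF

/-- A property of sections along a map, local, additive and stable under multiplication by
functions, has to be checked only on the sections with constant coefficients. -/
theorem induction [FiniteDimensional ℝ E] {p : (∀ q, TangentSpace 𝓘(ℝ, E) (F q)) → Prop}
    (hσ : SmoothAlongAt E' F σ q)
    (hcongr : ∀ ρ τ, SmoothAlongAt E' F ρ q → (∀ᶠ q' in 𝓝 q, ρ q' = τ q') → p ρ → p τ)
    (hadd : ∀ ρ τ, SmoothAlongAt E' F ρ q → SmoothAlongAt E' F τ q → p ρ → p τ →
      p (fun q' ↦ ρ q' + τ q'))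
    (hsmul : ∀ (a : A → ℝ) (ρ), ContMDiffAt 𝓘(ℝ, E') 𝓘(ℝ, ℝ) ∞ a q → SmoothAlongAt E' F ρ q →
      p ρ → p (fun q' ↦ a q' • ρ q'))
    (hext : ∀ u : TangentSpace 𝓘(ℝ, E) (F q), p (fun q' ↦ FiberBundle.extend E u (F q'))) :
    p σ := by
  classical
  have hF := hσ.contMDiffAt
  let b := Module.finBasis ℝ E
  let e := trivializationAt E (TangentSpace 𝓘(ℝ, E)) (F q)
  let a : Fin _ → A → ℝ := fun i q' ↦ b.repr (coordAlong F (F q) σ q') i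
  have ha : ∀ i, ContMDiffAt 𝓘(ℝ, E') 𝓘(ℝ, ℝ) ∞ (a i) q := fun i ↦ by
    have : ContDiff ℝ ∞ (fun v : E ↦ b.repr v i) :=
      (LinearMap.toContinuousLinearMap (b.coord i)).contDiff
    exact this.contMDiff.contMDiffAt.comp q hσ.coord
  let u : Fin _ → TangentSpace 𝓘(ℝ, E) (F q) := fun i ↦ e.symm (F q) (b i)
  have hs (s : Finset (Fin (Module.finrank ℝ E))) :
      SmoothAlongAt E' F (fun q' ↦ ∑ i ∈ s, a i q' • FiberBundle.extend E (u i) (F q')) q ∧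
      p (fun q' ↦ ∑ i ∈ s, a i q' • FiberBundle.extend E (u i) (F q')) := by
    induction s using Finset.induction_on with
    | empty =>
      refine ⟨by simpa using zero hF, ?_⟩
      -- The zero section is obtained as the function `0` times a constant-coefficient section.
      refine hcongr _ _ ?_ ?_ (hsmul (fun _ ↦ 0) _ contMDiffAt_const (extend_comp hF 0) (hext 0))
      · exact (extend_comp hF 0).smul contMDiffAt_const
      · exact .of_forall fun q' ↦ by simp
    | insert i s hi ih =>
      simp only [Finset.sum_insert hi]
      have h1 := (extend_comp hF (u i)).smul (ha i)
      exact ⟨h1.add ih.1, hadd _ _ h1 ih.1 (hsmul _ _ (ha i) (extend_comp hF _) (hext _)) ih.2⟩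
  refine hcongr _ _ (hs Finset.univ).1 ?_ (hs Finset.univ).2
  filter_upwards [eventually_mem_baseSet (E := E) hF.continuousAt] with q' hq'
  have h0 := FiberBundle.mem_baseSet_trivializationAt E (TangentSpace 𝓘(ℝ, E)) (F q)
  -- At nearby points the extension of `u i` still has coordinates `b i`, so the sum reassembles `σ`
  -- from its coordinates.
  have h2 : ∀ i, FiberBundle.extend E (u i) (F q') = e.symmₗ ℝ (F q') (b i) := fun i ↦ by
    simp only [FiberBundle.extend, u, e]
    rw [Trivialization.apply_mk_symm _ h0, Trivialization.coe_symmₗ _ hq']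
  simp only [h2, ← map_smul, ← map_sum, a]
  rw [b.sum_repr, Trivialization.coe_symmₗ _ hq']
  exact symm_coordAlong hq'

end SmoothAlongAt

end SectionsAlong

/-! ### Derivatives of vector-valued functions. -/

section Derivative

variable {E : Type*} [NormedAddCommGroup E] [NormedSpace ℝ E]
  {A : Type*} [TopologicalSpace A] [ChartedSpace E A]
  {V : Type*} [NormedAddCommGroup V] [NormedSpace ℝ V]

theorem mvfderiv_congr {f g : A → V} {q : A} (h : f =ᶠ[𝓝 q] g) :
    mvfderiv 𝓘(ℝ, E) f q = mvfderiv 𝓘(ℝ, E) g q := by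
  ext v
  have := congrArg (fun L : TangentSpace 𝓘(ℝ, E) q →L[ℝ] V ↦ L v)
    (h.mfderiv_eq (I := 𝓘(ℝ, E)) (I' := 𝓘(ℝ, V)))
  exact this

theorem mvfderiv_comp_vector {E' : Type*} [NormedAddCommGroup E'] [NormedSpace ℝ E']
    {B : Type*} [TopologicalSpace B] [ChartedSpace E' B] {g : B → V} {f : A → B} (q : A)
    (hg : MDifferentiableAt 𝓘(ℝ, E') 𝓘(ℝ, V) g (f q)) (hf : MDifferentiableAt 𝓘(ℝ, E) 𝓘(ℝ, E') f q)
    (x : TangentSpace 𝓘(ℝ, E) q) :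
    mvfderiv 𝓘(ℝ, E) (fun p ↦ g (f p)) q x
      = mvfderiv 𝓘(ℝ, E') g (f q) (mfderiv 𝓘(ℝ, E) 𝓘(ℝ, E') f q x) :=
  mfderiv_comp_apply q hg hf x

end Derivative

/-! ### The pullback connection: Leibniz rules, metric compatibility, parallel complex structure. -/

section Connection

variable {E : Type*} [NormedAddCommGroup E] [NormedSpace ℝ E]
  {N : Type*} [TopologicalSpace N] [ChartedSpace E N] [IsManifold 𝓘(ℝ, E) ∞ N]

theorem eventually_extend_add (y : N) (u v : TangentSpace 𝓘(ℝ, E) y) :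
    ∀ᶠ y' in 𝓝 y, (FiberBundle.extend E (u + v) y' : TangentSpace 𝓘(ℝ, E) y')
      = FiberBundle.extend E u y' + FiberBundle.extend E v y' := by
  have h0 := FiberBundle.mem_baseSet_trivializationAt E (TangentSpace 𝓘(ℝ, E)) y
  filter_upwards [(trivializationAt E (TangentSpace 𝓘(ℝ, E)) y).open_baseSet.mem_nhds h0]
    with y' hy'
  have := ((trivializationAt E (TangentSpace 𝓘(ℝ, E)) y).linear ℝ h0).1 u v
  simp only [FiberBundle.extend]
  rw [this, ← Trivialization.coe_symmₗ (R := ℝ) _ hy', map_add]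

theorem eventually_extend_smul (y : N) (c : ℝ) (u : TangentSpace 𝓘(ℝ, E) y) :
    ∀ᶠ y' in 𝓝 y, (FiberBundle.extend E (c • u) y' : TangentSpace 𝓘(ℝ, E) y')
      = c • FiberBundle.extend E u y' := by
  have h0 := FiberBundle.mem_baseSet_trivializationAt E (TangentSpace 𝓘(ℝ, E)) y
  filter_upwards [(trivializationAt E (TangentSpace 𝓘(ℝ, E)) y).open_baseSet.mem_nhds h0]
    with y' hy'
  have := ((trivializationAt E (TangentSpace 𝓘(ℝ, E)) y).linear ℝ h0).2 c u
  simp only [FiberBundle.extend]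
  rw [this, ← Trivialization.coe_symmₗ (R := ℝ) _ hy', map_smul]

theorem smoothAlongAt_extend (y : N) (u : TangentSpace 𝓘(ℝ, E) y) :
    SmoothAlongAt E (fun y : N ↦ y) (fun y' ↦ FiberBundle.extend E u y') y :=
  SmoothAlongAt.extend_comp (F := fun y : N ↦ y) contMDiffAt_id u

variable [RiemannianBundle (fun y : N ↦ TangentSpace 𝓘(ℝ, E) y)]

theorem metricDeriv_comm (y : N) (u v w : TangentSpace 𝓘(ℝ, E) y) :
    metricDeriv y u v w = metricDeriv y v u w := by
  simp only [metricDeriv, real_inner_comm]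

theorem metricDeriv_eq_sum (y : N) (u v w : TangentSpace 𝓘(ℝ, E) y) {ι : Type*} [Fintype ι]
    (b : OrthonormalBasis ι ℝ (TangentSpace 𝓘(ℝ, E) y)) :
    metricDeriv y u v w = ∑ i, inner ℝ (b i) w * metricDeriv y u v (b i) := by
  simp only [metricDeriv]
  conv_lhs => rw [← b.sum_repr' w]
  rw [map_sum]
  simp only [map_smul, smul_eq_mul]

section

variable [FiniteDimensional ℝ E]

/-- Torsion-freeness: exchanging `u` and `v` swaps the first two terms of the Koszul expression and
fixes the third. -/
theorem christoffel_comm (y : N) (u v : TangentSpace 𝓘(ℝ, E) y) :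
    christoffel y u v = christoffel y v u := by
  simp only [christoffel]
  refine Finset.sum_congr rfl fun i _ ↦ ?_
  rw [metricDeriv_comm y u v, add_comm]

variable {E' : Type*} [NormedAddCommGroup E'] [NormedSpace ℝ E']
  {A : Type*} [TopologicalSpace A] [ChartedSpace E' A]
  {F : A → N} {q : A} {σ τ : ∀ q, TangentSpace 𝓘(ℝ, E) (F q)}

/-- With `symmL` in place of `symm` the inverse trivialization is a linear map, to which `map_add`
and `map_smul` apply. -/
theorem pullbackCov_eq (F : A → N) (σ : ∀ q, TangentSpace 𝓘(ℝ, E) (F q)) (q : A)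
    (x : TangentSpace 𝓘(ℝ, E') q) :
    pullbackCov F σ q x = (trivializationAt E (TangentSpace 𝓘(ℝ, E)) (F q)).symmL ℝ (F q)
        (mvfderiv 𝓘(ℝ, E') (coordAlong F (F q) σ) q x)
      + christoffel (F q) (mfderiv 𝓘(ℝ, E') 𝓘(ℝ, E) F q x) (σ q) := by
  rw [Trivialization.symmL_apply _ (FiberBundle.mem_baseSet_trivializationAt' (F q))]
  rfl

theorem pullbackCov_congr (h : ∀ᶠ p in 𝓝 q, σ p = τ p) (x : TangentSpace 𝓘(ℝ, E') q) :
    pullbackCov F σ q x = pullbackCov F τ q x := by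
  rw [pullbackCov_eq, pullbackCov_eq, h.self_of_nhds,
    mvfderiv_congr (f := coordAlong F (F q) σ) (g := coordAlong F (F q) τ)
      (h.mono fun p hp ↦ by simp only [coordAlong, hp])]

/-- The section has constant coordinates near `q`, so only the Christoffel term survives. -/
theorem pullbackCov_extend (hF : ContinuousAt F q) (u : TangentSpace 𝓘(ℝ, E) (F q))
    (x : TangentSpace 𝓘(ℝ, E') q) :
    pullbackCov F (fun p ↦ FiberBundle.extend E u (F p)) q x
      = christoffel (F q) (mfderiv 𝓘(ℝ, E') 𝓘(ℝ, E) F q x) u := by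
  rw [pullbackCov_eq, mvfderiv_congr (f := coordAlong F (F q) _)
    ((eventually_mem_baseSet (E := E) hF).mono fun p hp ↦ coordAlong_extend (F q) u hp),
    mvfderiv_const, zero_apply, map_zero, zero_add, FiberBundle.extend_apply_self]

/-- The chain rule for the pullback connection. -/
theorem pullbackCov_comp {Y : ∀ y : N, TangentSpace 𝓘(ℝ, E) y}
    (hF : ContMDiffAt 𝓘(ℝ, E') 𝓘(ℝ, E) ∞ F q) (hY : SmoothAlongAt E (fun y : N ↦ y) Y (F q))
    (x : TangentSpace 𝓘(ℝ, E') q) :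
    pullbackCov F (fun p ↦ Y (F p)) q x
      = leviCivita Y (F q) (mfderiv 𝓘(ℝ, E') 𝓘(ℝ, E) F q x) := by
  have hid : mfderiv 𝓘(ℝ, E) 𝓘(ℝ, E) (fun y : N ↦ y) (F q) = ContinuousLinearMap.id ℝ _ :=
    mfderiv_id
  have h : mvfderiv 𝓘(ℝ, E') (coordAlong F (F q) (fun p ↦ Y (F p))) q x = _ :=
    mvfderiv_comp_vector (f := F) (g := coordAlong (fun y : N ↦ y) (F q) Y) q
      (hY.coord.mdifferentiableAt (by simp)) (hF.mdifferentiableAt (by simp)) x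
  rw [leviCivita, pullbackCov_eq, pullbackCov_eq, h, hid]
  rfl

theorem leviCivita_extend (y : N) (u x : TangentSpace 𝓘(ℝ, E) y) :
    leviCivita (fun y' ↦ FiberBundle.extend E u y') y x = christoffel y x u := by
  have hid : mfderiv 𝓘(ℝ, E) 𝓘(ℝ, E) (fun y : N ↦ y) y = ContinuousLinearMap.id ℝ _ :=
    mfderiv_id
  have h := pullbackCov_extend (F := fun y : N ↦ y) (q := y) continuousAt_id u x
  rw [hid] at h
  exact h

theorem IsKahler.smoothAlongAt
    {P : ∀ y : N, TangentSpace 𝓘(ℝ, E) y →L[ℝ] TangentSpace 𝓘(ℝ, E) y} (hP : IsKahler P)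
    (hσ : SmoothAlongAt E' F σ q) :
    SmoothAlongAt E' F (fun p ↦ P (F p) (σ p)) q :=
  ContMDiffAt.clm_bundle_apply (hP.smooth.contMDiffAt.comp q hσ.contMDiffAt) hσ

end

variable [IsContMDiffRiemannianBundle 𝓘(ℝ, E) ∞ E (fun y : N ↦ TangentSpace 𝓘(ℝ, E) y)]

theorem contMDiffAt_inner_extend (y : N) (u v : TangentSpace 𝓘(ℝ, E) y) :
    ContMDiffAt 𝓘(ℝ, E) 𝓘(ℝ, ℝ) ∞ (fun y' : N ↦ inner ℝ
      (FiberBundle.extend E u y' : TangentSpace 𝓘(ℝ, E) y')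
      (FiberBundle.extend E v y' : TangentSpace 𝓘(ℝ, E) y')) y :=
  ContMDiffAt.inner_bundle (smoothAlongAt_extend y u) (smoothAlongAt_extend y v)

theorem metricDeriv_add_left (y : N) (u u' v w : TangentSpace 𝓘(ℝ, E) y) :
    metricDeriv y (u + u') v w = metricDeriv y u v w + metricDeriv y u' v w := by
  have h := mvfderiv_fun_add
    ((contMDiffAt_inner_extend y u v).mdifferentiableAt (by simp))
    ((contMDiffAt_inner_extend y u' v).mdifferentiableAt (by simp))
  simp only [metricDeriv]
  rw [← add_apply, ← h]
  congr 1
  refine mvfderiv_congr ((eventually_extend_add y u u').mono fun y' hy' ↦ ?_)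
  simp only [hy', inner_add_left]

theorem metricDeriv_smul_left (y : N) (c : ℝ) (u v w : TangentSpace 𝓘(ℝ, E) y) :
    metricDeriv y (c • u) v w = c * metricDeriv y u v w := by
  have h := mvfderiv_fun_mul (f := fun _ : N ↦ c) mdifferentiableAt_const
    ((contMDiffAt_inner_extend y u v).mdifferentiableAt (by simp))
  simp only [mvfderiv_const, smul_zero, add_zero] at h
  simp only [metricDeriv]
  rw [← smul_eq_mul, ← smul_apply, ← h]
  congr 1
  refine mvfderiv_congr ((eventually_extend_smul y c u).mono fun y' hy' ↦ ?_)
  simp only [hy', real_inner_smul_left]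

theorem metricDeriv_add_middle (y : N) (u v v' w : TangentSpace 𝓘(ℝ, E) y) :
    metricDeriv y u (v + v') w = metricDeriv y u v w + metricDeriv y u v' w := by
  simp only [metricDeriv_comm y u, metricDeriv_add_left]

theorem metricDeriv_smul_middle (y : N) (c : ℝ) (u v w : TangentSpace 𝓘(ℝ, E) y) :
    metricDeriv y u (c • v) w = c * metricDeriv y u v w := by
  simp only [metricDeriv_comm y u, metricDeriv_smul_left]

theorem metricDeriv_eq_sum_middle (y : N) (u v w : TangentSpace 𝓘(ℝ, E) y) {ι : Type*} [Fintype ι]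
    (b : OrthonormalBasis ι ℝ (TangentSpace 𝓘(ℝ, E) y)) :
    metricDeriv y u v w = ∑ i, inner ℝ (b i) v * metricDeriv y u (b i) w := by
  let L : TangentSpace 𝓘(ℝ, E) y →ₗ[ℝ] ℝ :=
    { toFun := fun v ↦ metricDeriv y u v w
      map_add' := fun v v' ↦ metricDeriv_add_middle y u v v' w
      map_smul' := fun c v ↦ metricDeriv_smul_middle y c u v w }
  change L v = ∑ i, inner ℝ (b i) v * L (b i)
  conv_lhs => rw [← b.sum_repr' v]
  rw [map_sum]
  simp only [map_smul, smul_eq_mul]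

section

variable {E' : Type*} [NormedAddCommGroup E'] [NormedSpace ℝ E']
  {A : Type*} [TopologicalSpace A] [ChartedSpace E' A]
  {F : A → N} {q : A} {σ τ : ∀ q, TangentSpace 𝓘(ℝ, E) (F q)}

theorem SmoothAlongAt.contMDiffAt_inner (hσ : SmoothAlongAt E' F σ q) (hτ : SmoothAlongAt E' F τ q) :
    ContMDiffAt 𝓘(ℝ, E') 𝓘(ℝ, ℝ) ∞ (fun p ↦ inner ℝ (σ p) (τ p)) q :=
  ContMDiffAt.inner_bundle hσ hτ

end

variable [FiniteDimensional ℝ E]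

/-- The Koszul formula for the Christoffel symbols. -/
theorem inner_christoffel (y : N) (u v w : TangentSpace 𝓘(ℝ, E) y) :
    inner ℝ (christoffel y u v) w
      = (metricDeriv y v w u + metricDeriv y u w v - metricDeriv y u v w) / 2 := by
  -- `w` is expanded in the basis in whichever slot it occupies, to match the sum that defines
  -- `christoffel`.
  rw [metricDeriv_eq_sum_middle y v w u (stdOrthonormalBasis ℝ _),
    metricDeriv_eq_sum_middle y u w v (stdOrthonormalBasis ℝ _),
    metricDeriv_eq_sum y u v w (stdOrthonormalBasis ℝ _), christoffel, sum_inner,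
    ← Finset.sum_add_distrib, ← Finset.sum_sub_distrib, Finset.sum_div]
  refine Finset.sum_congr rfl fun i _ ↦ ?_
  rw [real_inner_smul_left]
  ring

/-- Metric compatibility for constant-coefficient fields: in the sum of the two Koszul formulas all
other terms cancel. -/
theorem metricDeriv_eq_inner_christoffel (y : N) (u v w : TangentSpace 𝓘(ℝ, E) y) :
    metricDeriv y u v w
      = inner ℝ (christoffel y w u) v + inner ℝ u (christoffel y w v) := by
  rw [real_inner_comm _ u, inner_christoffel, inner_christoffel,
    metricDeriv_comm y v u, metricDeriv_comm y w v]
  ring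

theorem christoffel_add_right (y : N) (u v v' : TangentSpace 𝓘(ℝ, E) y) :
    christoffel y u (v + v') = christoffel y u v + christoffel y u v' := by
  refine ext_inner_right ℝ fun w ↦ ?_
  simp only [inner_add_left, inner_christoffel, metricDeriv_add_left, metricDeriv_add_middle]
  simp only [metricDeriv, map_add]
  ring

theorem christoffel_smul_right (y : N) (c : ℝ) (u v : TangentSpace 𝓘(ℝ, E) y) :
    christoffel y u (c • v) = c • christoffel y u v := by
  refine ext_inner_right ℝ fun w ↦ ?_
  simp only [real_inner_smul_left, inner_christoffel, metricDeriv_smul_left,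
    metricDeriv_smul_middle]
  simp only [metricDeriv, map_smul, smul_eq_mul]
  ring

theorem christoffel_add_left (y : N) (u u' v : TangentSpace 𝓘(ℝ, E) y) :
    christoffel y (u + u') v = christoffel y u v + christoffel y u' v := by
  simp only [christoffel_comm y _ v, christoffel_add_right]

theorem christoffel_smul_left (y : N) (c : ℝ) (u v : TangentSpace 𝓘(ℝ, E) y) :
    christoffel y (c • u) v = c • christoffel y u v := by
  simp only [christoffel_comm y _ v, christoffel_smul_right]

variable {E' : Type*} [NormedAddCommGroup E'] [NormedSpace ℝ E']
  {A : Type*} [TopologicalSpace A] [ChartedSpace E' A]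
  {F : A → N} {q : A} {σ τ : ∀ q, TangentSpace 𝓘(ℝ, E) (F q)}

theorem pullbackCov_add (hσ : SmoothAlongAt E' F σ q) (hτ : SmoothAlongAt E' F τ q)
    (x : TangentSpace 𝓘(ℝ, E') q) :
    pullbackCov F (fun p ↦ σ p + τ p) q x = pullbackCov F σ q x + pullbackCov F τ q x := by
  have h := mvfderiv_fun_add (hσ.coord.mdifferentiableAt (by simp))
    (hτ.coord.mdifferentiableAt (by simp))
  have h' : coordAlong F (F q) (fun p ↦ σ p + τ p) =ᶠ[𝓝 q]
      fun p ↦ coordAlong F (F q) σ p + coordAlong F (F q) τ p :=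
    (eventually_mem_baseSet (E := E) hσ.contMDiffAt.continuousAt).mono
      fun p hp ↦ coordAlong_add hp
  rw [pullbackCov_eq, pullbackCov_eq, pullbackCov_eq, mvfderiv_congr h', h, christoffel_add_right,
    add_apply, map_add]
  abel

/-- The Leibniz rule: the derivative of `a` comes from differentiating coordinates, the Christoffel
term being linear in the section. -/
theorem pullbackCov_smul {a : A → ℝ} (ha : ContMDiffAt 𝓘(ℝ, E') 𝓘(ℝ, ℝ) ∞ a q)
    (hσ : SmoothAlongAt E' F σ q) (x : TangentSpace 𝓘(ℝ, E') q) :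
    pullbackCov F (fun p ↦ a p • σ p) q x
      = a q • pullbackCov F σ q x + mvfderiv 𝓘(ℝ, E') a q x • σ q := by
  have h := mvfderiv_fun_smul (ha.mdifferentiableAt (by simp))
    (hσ.coord.mdifferentiableAt (by simp))
  have h' : coordAlong F (F q) (fun p ↦ a p • σ p) =ᶠ[𝓝 q]
      fun p ↦ a p • coordAlong F (F q) σ p :=
    (eventually_mem_baseSet (E := E) hσ.contMDiffAt.continuousAt).mono
      fun p hp ↦ coordAlong_smul hp
  have h0 := FiberBundle.mem_baseSet_trivializationAt E (TangentSpace 𝓘(ℝ, E)) (F q)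
  rw [pullbackCov_eq, pullbackCov_eq, mvfderiv_congr h', h, christoffel_smul_right,
    add_apply, map_add, smul_apply, map_smul, ContinuousLinearMap.smulRight_apply, map_smul]
  have h2 : Trivialization.symmL ℝ (trivializationAt E (TangentSpace 𝓘(ℝ, E)) (F q)) (F q)
      (coordAlong F (F q) σ q) = σ q := by
    rw [Trivialization.symmL_apply _ h0]
    exact symm_coordAlong h0
  rw [h2, smul_add]
  abel

theorem pullbackCov_zero (hF : ContMDiffAt 𝓘(ℝ, E') 𝓘(ℝ, E) ∞ F q)
    (x : TangentSpace 𝓘(ℝ, E') q) :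
    pullbackCov F (fun p ↦ (0 : TangentSpace 𝓘(ℝ, E) (F p))) q x = 0 := by
  simpa [mvfderiv_const] using pullbackCov_smul (a := fun _ ↦ (0 : ℝ)) contMDiffAt_const
    (SmoothAlongAt.zero hF) x

theorem pullbackCov_add_vector (F : A → N) (σ : ∀ q, TangentSpace 𝓘(ℝ, E) (F q)) (q : A)
    (x x' : TangentSpace 𝓘(ℝ, E') q) :
    pullbackCov F σ q (x + x') = pullbackCov F σ q x + pullbackCov F σ q x' := by
  simp only [pullbackCov_eq, map_add, christoffel_add_left]
  abel

theorem pullbackCov_smul_vector (F : A → N) (σ : ∀ q, TangentSpace 𝓘(ℝ, E) (F q)) (q : A)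
    (c : ℝ) (x : TangentSpace 𝓘(ℝ, E') q) :
    pullbackCov F σ q (c • x) = c • pullbackCov F σ q x := by
  simp only [pullbackCov_eq, map_smul, christoffel_smul_left, smul_add]

/-- The pullback of the Levi-Civita connection is compatible with the metric. -/
theorem mvfderiv_inner (hσ : SmoothAlongAt E' F σ q) (hτ : SmoothAlongAt E' F τ q)
    (x : TangentSpace 𝓘(ℝ, E') q) :
    mvfderiv 𝓘(ℝ, E') (fun p ↦ inner ℝ (σ p) (τ p)) q x
      = inner ℝ (pullbackCov F σ q x) (τ q) + inner ℝ (σ q) (pullbackCov F τ q x) := by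
  have hF := hσ.contMDiffAt
  -- Reduces the first section to constant coefficients. It is used twice, the second time with the
  -- factors exchanged, so that both sections become constant-coefficient extensions.
  have key : ∀ {ρ υ : ∀ q, TangentSpace 𝓘(ℝ, E) (F q)}, SmoothAlongAt E' F ρ q →
      SmoothAlongAt E' F υ q →
      (∀ u : TangentSpace 𝓘(ℝ, E) (F q), mvfderiv 𝓘(ℝ, E')
        (fun p ↦ inner ℝ (FiberBundle.extend E u (F p) : TangentSpace 𝓘(ℝ, E) (F p)) (υ p)) q x
        = inner ℝ (pullbackCov F (fun p ↦ FiberBundle.extend E u (F p)) q x) (υ q)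
          + inner ℝ u (pullbackCov F υ q x)) →
      mvfderiv 𝓘(ℝ, E') (fun p ↦ inner ℝ (ρ p) (υ p)) q x
        = inner ℝ (pullbackCov F ρ q x) (υ q) + inner ℝ (ρ q) (pullbackCov F υ q x) := by
    intro ρ υ hρ hυ hbase
    refine hρ.induction (p := fun ρ ↦ mvfderiv 𝓘(ℝ, E') (fun p ↦ inner ℝ (ρ p) (υ p)) q x
      = inner ℝ (pullbackCov F ρ q x) (υ q) + inner ℝ (ρ q) (pullbackCov F υ q x)) ?_ ?_ ?_ ?_
    · intro ρ ρ' _ h ih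
      rw [← mvfderiv_congr (f := fun p ↦ inner ℝ (ρ p) (υ p)) (h.mono fun p hp ↦ by simp only [hp]),
        ih, pullbackCov_congr h, h.self_of_nhds]
    · intro ρ ρ' hρ hρ' ih ih'
      simp only [inner_add_left]
      rw [mvfderiv_fun_add ((hρ.contMDiffAt_inner hυ).mdifferentiableAt (by simp))
        ((hρ'.contMDiffAt_inner hυ).mdifferentiableAt (by simp)), add_apply, ih, ih', pullbackCov_add hρ hρ',
        inner_add_left]
      ring
    · intro a ρ ha hρ ih
      simp only [real_inner_smul_left]
      rw [mvfderiv_fun_mul (ha.mdifferentiableAt (by simp))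
        ((hρ.contMDiffAt_inner hυ).mdifferentiableAt (by simp)), add_apply, smul_apply, smul_apply, ih,
        pullbackCov_smul ha hρ, inner_add_left, real_inner_smul_left, real_inner_smul_left,
        smul_eq_mul, smul_eq_mul]
      ring
    · intro u
      beta_reduce
      rw [hbase, FiberBundle.extend_apply_self]
  refine key hσ hτ fun u ↦ ?_
  simp only [real_inner_comm _ (FiberBundle.extend E u _)]
  rw [key hτ (SmoothAlongAt.extend_comp hF u) fun v ↦ ?_]
  · rw [FiberBundle.extend_apply_self, add_comm, real_inner_comm, real_inner_comm u]
  -- Both factors now come from fields on `N`, so the inner product is a function on `N` composed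
  -- with `F`, and its derivative is `metricDeriv` at `F_* x`.
  · have h : mvfderiv 𝓘(ℝ, E') (fun p ↦ inner ℝ
        (FiberBundle.extend E v (F p) : TangentSpace 𝓘(ℝ, E) (F p))
        (FiberBundle.extend E u (F p) : TangentSpace 𝓘(ℝ, E) (F p))) q x = _ :=
      mvfderiv_comp_vector (f := F) q
        ((contMDiffAt_inner_extend (F q) v u).mdifferentiableAt (by simp))
        (hF.mdifferentiableAt (by simp)) x
    rw [h, pullbackCov_extend hF.continuousAt, pullbackCov_extend hF.continuousAt,
      FiberBundle.extend_apply_self]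
    exact metricDeriv_eq_inner_christoffel _ _ _ _

variable {P : ∀ y : N, TangentSpace 𝓘(ℝ, E) y →L[ℝ] TangentSpace 𝓘(ℝ, E) y}

/-- The complex structure is parallel for the pullback connection. -/
theorem IsKahler.pullbackCov_map (hP : IsKahler P) (hσ : SmoothAlongAt E' F σ q)
    (x : TangentSpace 𝓘(ℝ, E') q) :
    pullbackCov F (fun p ↦ P (F p) (σ p)) q x = P (F q) (pullbackCov F σ q x) := by
  have hF := hσ.contMDiffAt
  refine hσ.induction (p := fun σ ↦
    pullbackCov F (fun p ↦ P (F p) (σ p)) q x = P (F q) (pullbackCov F σ q x)) ?_ ?_ ?_ ?_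
  · intro ρ τ _ h ih
    rw [← pullbackCov_congr h, ← ih]
    exact (pullbackCov_congr (h.mono fun p hp ↦ by simp only [hp]) x).symm
  · intro ρ τ hρ hτ ihρ ihτ
    simp only [map_add]
    rw [pullbackCov_add (hP.smoothAlongAt hρ) (hP.smoothAlongAt hτ), ihρ, ihτ,
      pullbackCov_add hρ hτ, map_add]
  · intro a ρ ha hρ ih
    simp only [map_smul]
    rw [pullbackCov_smul ha (hP.smoothAlongAt hρ), ih, pullbackCov_smul ha hρ, map_add, map_smul,
      map_smul]
  · intro u
    -- A constant-coefficient section is the restriction of a field on `N`, to which the hypothesis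
    -- `∇P = 0` applies through the chain rule.
    have hu := smoothAlongAt_extend (F q) u
    rw [pullbackCov_comp hF hu, ← hP.parallel _ _ _ hu]
    exact pullbackCov_comp (Y := fun y ↦ P y (FiberBundle.extend E u y)) hF
      (hP.smoothAlongAt hu) x

end Connection

/-! ### The second fundamental form as a symmetric tensor. -/

section SecondFundamentalForm

variable {EM : Type*} [NormedAddCommGroup EM] [NormedSpace ℝ EM]
  {M : Type*} [TopologicalSpace M] [ChartedSpace EM M] [IsManifold 𝓘(ℝ, EM) ∞ M]
  {EN : Type*} [NormedAddCommGroup EN] [NormedSpace ℝ EN]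
  {N : Type*} [TopologicalSpace N] [ChartedSpace EN N] [IsManifold 𝓘(ℝ, EN) ∞ N]
  {F : M → N} {q : M} {X Y : ∀ q : M, TangentSpace 𝓘(ℝ, EM) q}

theorem SmoothAlongAt.push (hY : SmoothAlongAt EM (fun p : M ↦ p) Y q)
    (hF : ContMDiff 𝓘(ℝ, EM) 𝓘(ℝ, EN) ∞ F) : SmoothAlongAt EM F (push EN F Y) q :=
  (hF.contMDiff_tangentMap (m := ∞) (by simp)).contMDiffAt.comp q hY

/-- The tangent trivializations are differentials of charts. So `F_*` of a constant-coefficient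
field reads in charts as the derivative of `F` applied to a constant vector. -/
theorem coordAlong_push_extend (hF : ContMDiff 𝓘(ℝ, EM) 𝓘(ℝ, EN) ∞ F)
    (y : TangentSpace 𝓘(ℝ, EM) q) :
    ∀ᶠ p in 𝓝 q, coordAlong F (F q) (push EN F (fun p ↦ FiberBundle.extend EM y p)) p
      = fderiv ℝ (writtenInExtChartAt 𝓘(ℝ, EM) 𝓘(ℝ, EN) q F) (extChartAt 𝓘(ℝ, EM) q p)
        (mfderiv 𝓘(ℝ, EM) 𝓘(ℝ, EM) (extChartAt 𝓘(ℝ, EM) q) q y) := by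
  have : IsManifold 𝓘(ℝ, EM) 1 M := .of_le (n := ∞) (by simp)
  have : IsManifold 𝓘(ℝ, EN) 1 N := .of_le (n := ∞) (by simp)
  filter_upwards [(chartAt EM q).open_source.mem_nhds (mem_chart_source EM q),
    hF.continuous.continuousAt.eventually
      ((chartAt EN (F q)).open_source.mem_nhds (mem_chart_source EN (F q)))] with p hp hFp
  have h1 : coordAlong F (F q) (push EN F (fun p ↦ FiberBundle.extend EM y p)) p
      = mfderiv 𝓘(ℝ, EN) 𝓘(ℝ, EN) (extChartAt 𝓘(ℝ, EN) (F q)) (F p)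
        (push EN F (fun p ↦ FiberBundle.extend EM y p) p) := by
    rw [← TangentBundle.continuousLinearMapAt_trivializationAt hFp]
    exact (Trivialization.continuousLinearMapAt_apply_of_mem ℝ _ hFp _).symm
  have h2 : (FiberBundle.extend EM y p : TangentSpace 𝓘(ℝ, EM) p)
      = mfderivWithin 𝓘(ℝ, EM) 𝓘(ℝ, EM) (extChartAt 𝓘(ℝ, EM) q).symm (range 𝓘(ℝ, EM))
        (extChartAt 𝓘(ℝ, EM) q p) (mfderiv 𝓘(ℝ, EM) 𝓘(ℝ, EM) (extChartAt 𝓘(ℝ, EM) q) q y) := by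
    have ha : (FiberBundle.extend EM y p : TangentSpace 𝓘(ℝ, EM) p)
        = (trivializationAt EM (TangentSpace 𝓘(ℝ, EM)) q).symmL ℝ p
          ((trivializationAt EM (TangentSpace 𝓘(ℝ, EM)) q).continuousLinearMapAt ℝ q y) := by
      rw [Trivialization.symmL_apply _ hp,
        Trivialization.continuousLinearMapAt_apply_of_mem ℝ _ (mem_chart_source EM q)]
      rfl
    rw [ha, TangentBundle.continuousLinearMapAt_trivializationAt (mem_chart_source EM q)]
    exact congrArg (fun L : EM →L[ℝ] EM ↦
      L (mfderiv 𝓘(ℝ, EM) 𝓘(ℝ, EM) (extChartAt 𝓘(ℝ, EM) q) q y))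
      (TangentBundle.symmL_trivializationAt hp)
  have hps : p ∈ (extChartAt 𝓘(ℝ, EM) q).source := by simpa using hp
  have hφp : (extChartAt 𝓘(ℝ, EM) q).symm (extChartAt 𝓘(ℝ, EM) q p) = p :=
    (extChartAt 𝓘(ℝ, EM) q).left_inv hps
  have hd1 : MDifferentiableAt 𝓘(ℝ, EM) 𝓘(ℝ, EM) (extChartAt 𝓘(ℝ, EM) q).symm
      (extChartAt 𝓘(ℝ, EM) q p) := by
    have := mdifferentiableWithinAt_extChartAt_symm (I := 𝓘(ℝ, EM))
      ((extChartAt 𝓘(ℝ, EM) q).map_source hps)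
    simpa [mdifferentiableWithinAt_univ] using this
  have hd2 : MDifferentiableAt 𝓘(ℝ, EM) 𝓘(ℝ, EN) F
      ((extChartAt 𝓘(ℝ, EM) q).symm (extChartAt 𝓘(ℝ, EM) q p)) :=
    hF.contMDiffAt.mdifferentiableAt (by simp)
  have hd3 : MDifferentiableAt 𝓘(ℝ, EN) 𝓘(ℝ, EN) (extChartAt 𝓘(ℝ, EN) (F q))
      (F ((extChartAt 𝓘(ℝ, EM) q).symm (extChartAt 𝓘(ℝ, EM) q p))) := by
    rw [hφp]
    exact mdifferentiableAt_extChartAt hFp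
  rw [h1, push, h2, ← mfderiv_eq_fderiv]
  have h3 := mfderiv_comp_apply (extChartAt 𝓘(ℝ, EM) q p) hd3 (hd2.comp _ hd1)
    (mfderiv 𝓘(ℝ, EM) 𝓘(ℝ, EM) (extChartAt 𝓘(ℝ, EM) q) q y)
  have h4 := mfderiv_comp_apply (extChartAt 𝓘(ℝ, EM) q p) hd2 hd1
    (mfderiv 𝓘(ℝ, EM) 𝓘(ℝ, EM) (extChartAt 𝓘(ℝ, EM) q) q y)
  rw [h4] at h3
  have hr : range 𝓘(ℝ, EM) = univ := range_id
  rw [hr, mfderivWithin_univ]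
  -- `G` forgets that the tangent spaces depend on the base point, so that `hφp` can be substituted
  -- by `congrArg`.
  let G : M → EM → EN := fun m v ↦ mfderiv 𝓘(ℝ, EN) 𝓘(ℝ, EN) (extChartAt 𝓘(ℝ, EN) (F q)) (F m)
    (mfderiv 𝓘(ℝ, EM) 𝓘(ℝ, EN) F m v)
  exact (congrArg (fun m ↦ G m (mfderiv 𝓘(ℝ, EM) 𝓘(ℝ, EM) (extChartAt 𝓘(ℝ, EM) q).symm
    (extChartAt 𝓘(ℝ, EM) q p) (mfderiv 𝓘(ℝ, EM) 𝓘(ℝ, EM) (extChartAt 𝓘(ℝ, EM) q) q y)))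
    hφp.symm).trans h3.symm

/-- Both sides are the second derivative of `F` in charts, which is symmetric because `F` is smooth.
-/
theorem mvfderiv_coordAlong_push_extend (hF : ContMDiff 𝓘(ℝ, EM) 𝓘(ℝ, EN) ∞ F)
    (x y : TangentSpace 𝓘(ℝ, EM) q) :
    mvfderiv 𝓘(ℝ, EM)
        (coordAlong F (F q) (push EN F (fun p ↦ FiberBundle.extend EM y p))) q x
      = mvfderiv 𝓘(ℝ, EM)
        (coordAlong F (F q) (push EN F (fun p ↦ FiberBundle.extend EM x p))) q y := by
  have : IsManifold 𝓘(ℝ, EM) 1 M := .of_le (n := ∞) (by simp)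
  set f := writtenInExtChartAt 𝓘(ℝ, EM) 𝓘(ℝ, EN) q F with hf
  set φ := extChartAt 𝓘(ℝ, EM) q with hφ
  have hfs : ContDiffAt ℝ ∞ f (φ q) := by
    have := (contMDiffAt_iff.1 (hF.contMDiffAt (x := q))).2
    simpa [contDiffWithinAt_univ, hf, hφ, writtenInExtChartAt] using this
  have hdf : DifferentiableAt ℝ (fderiv ℝ f) (φ q) :=
    (hfs.fderiv_right (m := ∞) (by simp)).differentiableAt (by simp)
  have hgen (v w : EM) :
      fderiv ℝ (fun z ↦ fderiv ℝ f z w) (φ q) v = fderiv ℝ (fderiv ℝ f) (φ q) v w := by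
    rw [fderiv_clm_apply hdf (differentiableAt_const _)]
    simp
  have key : ∀ x y : TangentSpace 𝓘(ℝ, EM) q, mvfderiv 𝓘(ℝ, EM)
        (coordAlong F (F q) (push EN F (fun p ↦ FiberBundle.extend EM y p))) q x
      = fderiv ℝ (fderiv ℝ f) (φ q) (mfderiv 𝓘(ℝ, EM) 𝓘(ℝ, EM) φ q x)
        (mfderiv 𝓘(ℝ, EM) 𝓘(ℝ, EM) φ q y) := by
    intro x y
    have hd : DifferentiableAt ℝ (fun z ↦ fderiv ℝ f z (mfderiv 𝓘(ℝ, EM) 𝓘(ℝ, EM) φ q y)) (φ q) :=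
      hdf.clm_apply (differentiableAt_const _)
    rw [mvfderiv_congr (coordAlong_push_extend hF y)]
    rw [mvfderiv_comp_vector (f := φ)
      (g := fun z ↦ fderiv ℝ f z (mfderiv 𝓘(ℝ, EM) 𝓘(ℝ, EM) φ q y)) q hd.mdifferentiableAt
      (mdifferentiableAt_extChartAt (mem_chart_source EM q))]
    change mfderiv 𝓘(ℝ, EM) 𝓘(ℝ, EN)
      (fun z ↦ fderiv ℝ f z (mfderiv 𝓘(ℝ, EM) 𝓘(ℝ, EM) φ q y)) (φ q) _ = _
    rw [mfderiv_eq_fderiv]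
    exact hgen _ _
  rw [key, key]
  exact (hfs.isSymmSndFDerivAt (by
    simpa using (show ((2 : ℕ∞) : WithTop ℕ∞) ≤ ((⊤ : ℕ∞) : WithTop ℕ∞) from mod_cast le_top))).eq _ _

variable [FiniteDimensional ℝ EM] [FiniteDimensional ℝ EN]
  [RiemannianBundle (fun q : M ↦ TangentSpace 𝓘(ℝ, EM) q)]
  [RiemannianBundle (fun y : N ↦ TangentSpace 𝓘(ℝ, EN) y)]

theorem secondFundamentalForm_congr_left {X' : ∀ q : M, TangentSpace 𝓘(ℝ, EM) q}
    (h : X q = X' q) : secondFundamentalForm EN F X Y q = secondFundamentalForm EN F X' Y q := by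
  simp only [secondFundamentalForm, h]

theorem secondFundamentalForm_congr_right {Y' : ∀ q : M, TangentSpace 𝓘(ℝ, EM) q}
    (h : ∀ᶠ p in 𝓝 q, Y p = Y' p) :
    secondFundamentalForm EN F X Y q = secondFundamentalForm EN F X Y' q := by
  simp only [secondFundamentalForm, leviCivita]
  rw [pullbackCov_congr h, pullbackCov_congr (σ := push EN F Y) (τ := push EN F Y')
    (h.mono fun p hp ↦ by simp only [push, hp])]

variable
  [IsContMDiffRiemannianBundle 𝓘(ℝ, EM) ∞ EM (fun q : M ↦ TangentSpace 𝓘(ℝ, EM) q)]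
  [IsContMDiffRiemannianBundle 𝓘(ℝ, EN) ∞ EN (fun y : N ↦ TangentSpace 𝓘(ℝ, EN) y)]

theorem secondFundamentalForm_add_left (X X' : ∀ q : M, TangentSpace 𝓘(ℝ, EM) q) :
    secondFundamentalForm EN F (fun p ↦ X p + X' p) Y q
      = secondFundamentalForm EN F X Y q + secondFundamentalForm EN F X' Y q := by
  simp only [secondFundamentalForm, leviCivita, pullbackCov_add_vector, map_add]
  abel

theorem secondFundamentalForm_smul_left (c : ℝ) (X : ∀ q : M, TangentSpace 𝓘(ℝ, EM) q) :
    secondFundamentalForm EN F (fun p ↦ c • X p) Y q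
      = c • secondFundamentalForm EN F X Y q := by
  simp only [secondFundamentalForm, leviCivita, pullbackCov_smul_vector, map_smul, smul_sub]

theorem secondFundamentalForm_add_right (hF : ContMDiff 𝓘(ℝ, EM) 𝓘(ℝ, EN) ∞ F)
    {Y' : ∀ q : M, TangentSpace 𝓘(ℝ, EM) q} (hY : SmoothAlongAt EM (fun p : M ↦ p) Y q)
    (hY' : SmoothAlongAt EM (fun p : M ↦ p) Y' q) :
    secondFundamentalForm EN F X (fun p ↦ Y p + Y' p) q
      = secondFundamentalForm EN F X Y q + secondFundamentalForm EN F X Y' q := by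
  have h : push EN F (fun p ↦ Y p + Y' p) = fun p ↦ push EN F Y p + push EN F Y' p := by
    funext p
    simp only [push, map_add]
  simp only [secondFundamentalForm, leviCivita]
  rw [h, pullbackCov_add (hY.push hF) (hY'.push hF), pullbackCov_add hY hY', map_add]
  abel

/-- The Leibniz terms of the two connections are both `da(X) F_*Y` and cancel. -/
theorem secondFundamentalForm_smul_right (hF : ContMDiff 𝓘(ℝ, EM) 𝓘(ℝ, EN) ∞ F) {a : M → ℝ}
    (ha : ContMDiffAt 𝓘(ℝ, EM) 𝓘(ℝ, ℝ) ∞ a q) (hY : SmoothAlongAt EM (fun p : M ↦ p) Y q) :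
    secondFundamentalForm EN F X (fun p ↦ a p • Y p) q
      = a q • secondFundamentalForm EN F X Y q := by
  have h : push EN F (fun p ↦ a p • Y p) = fun p ↦ a p • push EN F Y p := by
    funext p
    simp only [push, map_smul]
  simp only [secondFundamentalForm, leviCivita]
  rw [h, pullbackCov_smul ha (hY.push hF), pullbackCov_smul ha hY, map_add, map_smul, map_smul,
    smul_sub]
  simp only [push]
  abel

/-- The second fundamental form of a smooth map at a point, as a bilinear map. -/
noncomputable def hessian (hF : ContMDiff 𝓘(ℝ, EM) 𝓘(ℝ, EN) ∞ F) (q : M) :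
    TangentSpace 𝓘(ℝ, EM) q →ₗ[ℝ] TangentSpace 𝓘(ℝ, EM) q →ₗ[ℝ] TangentSpace 𝓘(ℝ, EN) (F q) :=
  LinearMap.mk₂ ℝ
    (fun x y ↦ secondFundamentalForm EN F (fun p ↦ FiberBundle.extend EM x p)
      (fun p ↦ FiberBundle.extend EM y p) q)
    (fun x x' y ↦ by
      rw [← secondFundamentalForm_add_left]
      exact secondFundamentalForm_congr_left (eventually_extend_add q x x').self_of_nhds)
    (fun c x y ↦ by
      rw [← secondFundamentalForm_smul_left]
      exact secondFundamentalForm_congr_left (eventually_extend_smul q c x).self_of_nhds)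
    (fun x y y' ↦ by
      rw [← secondFundamentalForm_add_right hF (smoothAlongAt_extend q y)
        (smoothAlongAt_extend q y')]
      exact secondFundamentalForm_congr_right (eventually_extend_add q y y'))
    (fun c x y ↦ by
      rw [← secondFundamentalForm_smul_right (a := fun _ ↦ c) hF contMDiffAt_const
        (smoothAlongAt_extend q y)]
      exact secondFundamentalForm_congr_right (eventually_extend_smul q c y))

theorem hessian_extend (hF : ContMDiff 𝓘(ℝ, EM) 𝓘(ℝ, EN) ∞ F)
    (x y : TangentSpace 𝓘(ℝ, EM) q) :
    hessian hF q x y = secondFundamentalForm EN F (fun p ↦ FiberBundle.extend EM x p)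
      (fun p ↦ FiberBundle.extend EM y p) q := rfl

/-- The second fundamental form is a tensor. -/
theorem secondFundamentalForm_eq_hessian (hF : ContMDiff 𝓘(ℝ, EM) 𝓘(ℝ, EN) ∞ F)
    (hY : SmoothAlongAt EM (fun p : M ↦ p) Y q) :
    secondFundamentalForm EN F X Y q = hessian hF q (X q) (Y q) := by
  refine hY.induction (p := fun Y ↦
    secondFundamentalForm EN F X Y q = hessian hF q (X q) (Y q)) ?_ ?_ ?_ ?_
  · intro Y Y' _ h ih
    rw [← secondFundamentalForm_congr_right h, ih, h.self_of_nhds]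
  · intro Y Y' hY hY' ih ih'
    rw [secondFundamentalForm_add_right hF hY hY', ih, ih', map_add]
  · intro a Y ha hY ih
    rw [secondFundamentalForm_smul_right hF ha hY, ih, map_smul]
  · intro u
    beta_reduce
    rw [FiberBundle.extend_apply_self, hessian_extend]
    exact secondFundamentalForm_congr_left (FiberBundle.extend_apply_self EM (X q)).symm

/-- The second fundamental form is symmetric. -/
theorem hessian_comm (hF : ContMDiff 𝓘(ℝ, EM) 𝓘(ℝ, EN) ∞ F)
    (x y : TangentSpace 𝓘(ℝ, EM) q) : hessian hF q x y = hessian hF q y x := by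
  simp only [hessian_extend, secondFundamentalForm]
  rw [leviCivita_extend, leviCivita_extend, pullbackCov_eq, pullbackCov_eq]
  simp only [push, FiberBundle.extend_apply_self]
  -- The Christoffel terms of `M` and of `N` are symmetric separately; the second derivative of `F`
  -- in charts remains.
  rw [christoffel_comm q x y, christoffel_comm (F q) (mfderiv 𝓘(ℝ, EM) 𝓘(ℝ, EN) F q x)]
  congr 3
  exact mvfderiv_coordAlong_push_extend hF x y

end SecondFundamentalForm

/-! ### Smoothness from inner products with a frame. -/

section Projection

variable {E : Type*} [NormedAddCommGroup E] [NormedSpace ℝ E]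
  {N : Type*} [TopologicalSpace N] [ChartedSpace E N] [IsManifold 𝓘(ℝ, E) ∞ N]
  {E' : Type*} [NormedAddCommGroup E'] [NormedSpace ℝ E']
  {A : Type*} [TopologicalSpace A] [ChartedSpace E' A]
  {F : A → N} {q : A}

theorem contMDiffAt_det {ι : Type*} [Fintype ι] [DecidableEq ι] {G : A → Matrix ι ι ℝ}
    (h : ∀ i j, ContMDiffAt 𝓘(ℝ, E') 𝓘(ℝ, ℝ) ∞ (fun p ↦ G p i j) q) :
    ContMDiffAt 𝓘(ℝ, E') 𝓘(ℝ, ℝ) ∞ (fun p ↦ (G p).det) q := by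
  simp only [Matrix.det_apply']
  exact contMDiffAt_finsetSum fun s _ ↦
    contMDiffAt_const.mul (contMDiffAt_finsetProd fun i _ ↦ h _ _)

/-- Cramer's rule: an entry of the inverse is a cofactor divided by the determinant. -/
theorem contMDiffAt_matrix_inv_apply {ι : Type*} [Fintype ι] [DecidableEq ι] {G : A → Matrix ι ι ℝ}
    (h : ∀ i j, ContMDiffAt 𝓘(ℝ, E') 𝓘(ℝ, ℝ) ∞ (fun p ↦ G p i j) q) (h0 : (G q).det ≠ 0)
    (i j : ι) : ContMDiffAt 𝓘(ℝ, E') 𝓘(ℝ, ℝ) ∞ (fun p ↦ (G p)⁻¹ i j) q := by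
  simp only [Matrix.inv_def, Ring.inverse_eq_inv', Matrix.smul_apply, smul_eq_mul,
    Matrix.adjugate_apply]
  refine ((contMDiffAt_det h).inv₀ h0).mul (contMDiffAt_det fun k l ↦ ?_)
  simp only [Matrix.updateRow_apply]
  split_ifs
  · exact contMDiffAt_const
  · exact h k l

variable [RiemannianBundle (fun y : N ↦ TangentSpace 𝓘(ℝ, E) y)]
  [IsContMDiffRiemannianBundle 𝓘(ℝ, E) ∞ E (fun y : N ↦ TangentSpace 𝓘(ℝ, E) y)]

/-- A section of the span of smooth linearly independent sections is smooth as soon as its inner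
products with these sections are smooth. -/
theorem SmoothAlongAt.of_inner (hF : ContMDiffAt 𝓘(ℝ, E') 𝓘(ℝ, E) ∞ F q) {ι : Type*} [Fintype ι]
    {σ : ι → ∀ q, TangentSpace 𝓘(ℝ, E) (F q)} {τ : ∀ q, TangentSpace 𝓘(ℝ, E) (F q)}
    (hσ : ∀ i, SmoothAlongAt E' F (σ i) q)
    (hli : ∀ᶠ p in 𝓝 q, LinearIndependent ℝ (fun i ↦ σ i p))
    (hτ : ∀ᶠ p in 𝓝 q, τ p ∈ Submodule.span ℝ (range (fun i ↦ σ i p)))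
    (hin : ∀ i, ContMDiffAt 𝓘(ℝ, E') 𝓘(ℝ, ℝ) ∞ (fun p ↦ inner ℝ (σ i p) (τ p)) q) :
    SmoothAlongAt E' F τ q := by
  classical
  let G : A → Matrix ι ι ℝ := fun p ↦ Matrix.gram ℝ (fun i ↦ σ i p)
  have hdet : ∀ {p}, LinearIndependent ℝ (fun i ↦ σ i p) → (G p).det ≠ 0 := fun h ↦
    Matrix.det_gram_ne_zero_iff_linearIndependent.2 h
  have hG : ∀ i j, ContMDiffAt 𝓘(ℝ, E') 𝓘(ℝ, ℝ) ∞ (fun p ↦ G p i j) q := fun i j ↦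
    (hσ i).contMDiffAt_inner (hσ j)
  -- The coefficients of `τ` in the frame solve a linear system whose matrix is the Gram matrix.
  let a : ι → A → ℝ := fun i p ↦ ∑ j, (G p)⁻¹ i j * inner ℝ (σ j p) (τ p)
  have ha : ∀ i, ContMDiffAt 𝓘(ℝ, E') 𝓘(ℝ, ℝ) ∞ (a i) q := fun i ↦
    contMDiffAt_finsetSum fun j _ ↦
      (contMDiffAt_matrix_inv_apply hG (hdet hli.self_of_nhds) i j).mul (hin j)
  refine (SmoothAlongAt.sum hF Finset.univ fun i _ ↦ (hσ i).smul (ha i)).congr ?_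
  filter_upwards [hli, hτ] with p hp hτp
  obtain ⟨d, hd⟩ := (Submodule.mem_span_range_iff_exists_fun ℝ).1 hτp
  have hc : (fun j ↦ inner ℝ (σ j p) (τ p)) = (G p).mulVec d := by
    funext j
    rw [← hd, inner_sum]
    simp only [real_inner_smul_right, Matrix.mulVec, dotProduct, G, Matrix.gram_apply, mul_comm]
  have hda : ∀ i, a i p = d i := fun i ↦ by
    change (G p)⁻¹.mulVec (fun j ↦ inner ℝ (σ j p) (τ p)) i = d i
    rw [hc, Matrix.mulVec_mulVec, Matrix.nonsing_inv_mul _ (hdet hp).isUnit, Matrix.one_mulVec]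
  simp only [hda, hd]

end Projection

/-! ### Riemannian maps: horizontal projection and normality of the second fundamental form. -/

section RiemannianMap

variable {EM : Type*} [NormedAddCommGroup EM] [NormedSpace ℝ EM]
  {M : Type*} [TopologicalSpace M] [ChartedSpace EM M]
  {EN : Type*} [NormedAddCommGroup EN] [NormedSpace ℝ EN]
  {N : Type*} [TopologicalSpace N] [ChartedSpace EN N]
  {F : M → N} {q : M} {X : ∀ q : M, TangentSpace 𝓘(ℝ, EM) q}

theorem mem_vert {x : TangentSpace 𝓘(ℝ, EM) q} :
    x ∈ vert EM EN F q ↔ mfderiv 𝓘(ℝ, EM) 𝓘(ℝ, EN) F q x = 0 := Iff.rfl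

theorem mfderiv_mem_rangeD (x : TangentSpace 𝓘(ℝ, EM) q) :
    mfderiv 𝓘(ℝ, EM) 𝓘(ℝ, EN) F q x ∈ rangeD EM EN F q := ⟨x, rfl⟩

variable [FiniteDimensional ℝ EM]
  [RiemannianBundle (fun q : M ↦ TangentSpace 𝓘(ℝ, EM) q)]

theorem sub_starProjection_horiz_mem (x : TangentSpace 𝓘(ℝ, EM) q) :
    x - (horiz EM EN F q).starProjection x ∈ vert EM EN F q := by
  have h := (horiz EM EN F q).sub_starProjection_mem_orthogonal x
  rwa [horiz, Submodule.orthogonal_orthogonal] at h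

theorem mfderiv_starProjection_horiz (x : TangentSpace 𝓘(ℝ, EM) q) :
    mfderiv 𝓘(ℝ, EM) 𝓘(ℝ, EN) F q ((horiz EM EN F q).starProjection x)
      = mfderiv 𝓘(ℝ, EM) 𝓘(ℝ, EN) F q x := by
  have h := mem_vert.1 (sub_starProjection_horiz_mem (EN := EN) (F := F) x)
  rw [map_sub, sub_eq_zero] at h
  exact h.symm

variable [RiemannianBundle (fun y : N ↦ TangentSpace 𝓘(ℝ, EN) y)]

namespace IsRiemannianMap

/-- This expresses the horizontal projection through `F_*` and the two metrics. Its smoothness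
follows without any prior knowledge that the rank of `F` is locally constant. -/
theorem inner_mfderiv (hF : IsRiemannianMap EM EN F) (x y : TangentSpace 𝓘(ℝ, EM) q) :
    inner ℝ (mfderiv 𝓘(ℝ, EM) 𝓘(ℝ, EN) F q x) (mfderiv 𝓘(ℝ, EM) 𝓘(ℝ, EN) F q y)
      = inner ℝ x ((horiz EM EN F q).starProjection y) := by
  rw [← mfderiv_starProjection_horiz x, ← mfderiv_starProjection_horiz y,
    hF.isometry q _ (Submodule.starProjection_apply_mem _ _) _
      (Submodule.starProjection_apply_mem _ _),
    Submodule.inner_starProjection_left_eq_right,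
    Submodule.starProjection_eq_self_iff.2 (Submodule.starProjection_apply_mem _ _)]

variable [IsManifold 𝓘(ℝ, EM) ∞ M] [IsManifold 𝓘(ℝ, EN) ∞ N]
  [IsContMDiffRiemannianBundle 𝓘(ℝ, EM) ∞ EM (fun q : M ↦ TangentSpace 𝓘(ℝ, EM) q)]
  [IsContMDiffRiemannianBundle 𝓘(ℝ, EN) ∞ EN (fun y : N ↦ TangentSpace 𝓘(ℝ, EN) y)]

/-- The orthogonal projection to `(ker F_*)^⊥` of a smooth vector field is smooth. -/
theorem smoothAlongAt_starProjection_horiz (hF : IsRiemannianMap EM EN F)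
    (hX : SmoothAlongAt EM (fun p : M ↦ p) X q) :
    SmoothAlongAt EM (fun p : M ↦ p) (fun p ↦ (horiz EM EN F p).starProjection (X p)) q := by
  let e := trivializationAt EM (TangentSpace 𝓘(ℝ, EM)) q
  have hq : q ∈ e.baseSet := FiberBundle.mem_baseSet_trivializationAt' q
  have hfr := e.isLocalFrameOn_localFrame_baseSet 𝓘(ℝ, EM) ∞ (Module.finBasis ℝ EM)
  have hs := fun i ↦ hfr.contMDiffAt e.open_baseSet hq i
  refine SmoothAlongAt.of_inner (F := fun p : M ↦ p) contMDiffAt_id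
    (σ := e.localFrame (Module.finBasis ℝ EM)) hs ?_ ?_ fun i ↦ ?_
  · filter_upwards [e.open_baseSet.mem_nhds hq] with p hp using hfr.linearIndependent hp
  · filter_upwards [e.open_baseSet.mem_nhds hq] with p hp
    exact hfr.generating hp Submodule.mem_top
  · simp only [← hF.inner_mfderiv]
    exact ((show SmoothAlongAt EM (fun p : M ↦ p) _ q from hs i).push hF.smooth).contMDiffAt_inner
      (hX.push hF.smooth)

/-- Projecting the constant-coefficient extensions keeps their values at `q`; orthonormality is
required only there. -/
theorem exists_isFrameAt_horiz (hF : IsRiemannianMap EM EN F) {ι : Type*}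
    {e : ι → TangentSpace 𝓘(ℝ, EM) q} (he : Orthonormal ℝ e) (hmem : ∀ i, e i ∈ horiz EM EN F q) :
    ∃ E : ι → ∀ p : M, TangentSpace 𝓘(ℝ, EM) p,
      IsFrameAt (horiz EM EN F) q E ∧ ∀ i, E i q = e i := by
  have hq : ∀ i, (horiz EM EN F q).starProjection (FiberBundle.extend EM (e i) q) = e i :=
    fun i ↦ by
      rw [FiberBundle.extend_apply_self]
      exact Submodule.starProjection_eq_self_iff.2 (hmem i)
  refine ⟨fun i p ↦ (horiz EM EN F p).starProjection (FiberBundle.extend EM (e i) p), ?_, hq⟩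
  exact
    { smooth := fun i ↦ hF.smoothAlongAt_starProjection_horiz (smoothAlongAt_extend q (e i))
      mem := fun i ↦ .of_forall fun p ↦ Submodule.starProjection_apply_mem _ _
      orthonormal := by simpa only [hq] using he }

/-- The complementary projection makes the fields vertical at every point, so that `F_*` of them is
the zero section. -/
theorem exists_isFrameAt_vert (hF : IsRiemannianMap EM EN F) {ι : Type*}
    {u : ι → TangentSpace 𝓘(ℝ, EM) q} (hu : Orthonormal ℝ u) (hmem : ∀ i, u i ∈ vert EM EN F q) :
    ∃ U : ι → ∀ p : M, TangentSpace 𝓘(ℝ, EM) p,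
      IsFrameAt (vert EM EN F) q U ∧ (∀ i p, U i p ∈ vert EM EN F p) ∧ ∀ i, U i q = u i := by
  have hq : ∀ i, FiberBundle.extend EM (u i) q
      - (horiz EM EN F q).starProjection (FiberBundle.extend EM (u i) q) = u i := fun i ↦ by
    rw [FiberBundle.extend_apply_self, (Submodule.starProjection_apply_eq_zero_iff _).2, sub_zero]
    rw [horiz, Submodule.orthogonal_orthogonal]
    exact hmem i
  refine ⟨fun i p ↦ FiberBundle.extend EM (u i) p
    - (horiz EM EN F p).starProjection (FiberBundle.extend EM (u i) p), ?_,
    fun i p ↦ sub_starProjection_horiz_mem _, hq⟩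
  exact
    { smooth := fun i ↦ (smoothAlongAt_extend q (u i)).sub
        (hF.smoothAlongAt_starProjection_horiz (smoothAlongAt_extend q (u i)))
      mem := fun i ↦ .of_forall fun p ↦ sub_starProjection_horiz_mem _
      orthonormal := by simpa only [hq] using hu }

variable [FiniteDimensional ℝ EN]

/-- Differentiate `g_N(F_*Y, F_*Z) = g_M(Y, Z)`, valid for horizontal `Y, Z`, along `x` and subtract
the two metric-compatibility formulas. -/
theorem inner_hessian_add_inner_hessian (hF : IsRiemannianMap EM EN F)
    (x : TangentSpace 𝓘(ℝ, EM) q) {y z : TangentSpace 𝓘(ℝ, EM) q}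
    (hy : y ∈ horiz EM EN F q) (hz : z ∈ horiz EM EN F q) :
    inner ℝ (hessian hF.smooth q x y) (mfderiv 𝓘(ℝ, EM) 𝓘(ℝ, EN) F q z)
      + inner ℝ (hessian hF.smooth q x z) (mfderiv 𝓘(ℝ, EM) 𝓘(ℝ, EN) F q y) = 0 := by
  let Z : TangentSpace 𝓘(ℝ, EM) q → ∀ p : M, TangentSpace 𝓘(ℝ, EM) p := fun z p ↦
    (horiz EM EN F p).starProjection (FiberBundle.extend EM z p)
  have hZs (z) : SmoothAlongAt EM (fun p : M ↦ p) (Z z) q :=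
    hF.smoothAlongAt_starProjection_horiz (smoothAlongAt_extend q z)
  have hZq : ∀ {z}, z ∈ horiz EM EN F q → Z z q = z := fun {z} hz ↦ by
    simp only [Z, FiberBundle.extend_apply_self]
    exact Submodule.starProjection_eq_self_iff.2 hz
  have hsff : ∀ {z w}, z ∈ horiz EM EN F q → w ∈ horiz EM EN F q →
      inner ℝ (hessian hF.smooth q x z) (mfderiv 𝓘(ℝ, EM) 𝓘(ℝ, EN) F q w)
        = inner ℝ (pullbackCov F (push EN F (Z z)) q x) (push EN F (Z w) q)
          - inner ℝ (leviCivita (Z z) q x) w := fun {z w} hz hw ↦ by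
    have h := secondFundamentalForm_eq_hessian (X := fun p ↦ FiberBundle.extend EM x p)
      hF.smooth (hZs z)
    simp only [hZq hz, FiberBundle.extend_apply_self] at h
    rw [← h, secondFundamentalForm, inner_sub_left, hF.inner_mfderiv,
      Submodule.starProjection_eq_self_iff.2 hw, push, hZq hw, FiberBundle.extend_apply_self]
  have hM := mvfderiv_inner (hZs y) (hZs z) x
  have hN := mvfderiv_inner ((hZs y).push hF.smooth) ((hZs z).push hF.smooth) x
  have heq : (fun p ↦ inner ℝ (push EN F (Z y) p) (push EN F (Z z) p))
      = fun p ↦ inner ℝ (Z y p) (Z z p) := by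
    funext p
    exact hF.isometry p _ (Submodule.starProjection_apply_mem _ _) _
      (Submodule.starProjection_apply_mem _ _)
  rw [heq, hM, hZq hy, hZq hz] at hN
  rw [hsff hy hz, hsff hz hy]
  have h1 := real_inner_comm (pullbackCov F (push EN F (Z z)) q x) (push EN F (Z y) q)
  have h2 := real_inner_comm (leviCivita (Z z) q x) y
  simp only [leviCivita] at h2 ⊢
  linarith

/-- On `(ker F_*)^⊥`, the second fundamental form of a Riemannian map takes values in
`(range F_*)^⊥`. -/
theorem hessian_mem_orthogonal (hF : IsRiemannianMap EM EN F) {x y : TangentSpace 𝓘(ℝ, EM) q}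
    (hx : x ∈ horiz EM EN F q) (hy : y ∈ horiz EM EN F q) :
    hessian hF.smooth q x y ∈ (rangeD EM EN F q)ᗮ := by
  have key : ∀ z ∈ horiz EM EN F q,
      inner ℝ (hessian hF.smooth q x y) (mfderiv 𝓘(ℝ, EM) 𝓘(ℝ, EN) F q z) = 0 := fun z hz ↦ by
    -- A trilinear form symmetric in its first two arguments and skew in its last two vanishes:
    -- combine the skewness relations for the cyclic permutations.
    have h1 := hF.inner_hessian_add_inner_hessian x hy hz
    have h2 := hF.inner_hessian_add_inner_hessian z hx hy
    have h3 := hF.inner_hessian_add_inner_hessian y hz hx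
    rw [hessian_comm _ x z] at h1
    rw [hessian_comm _ z y] at h2
    rw [hessian_comm _ y x] at h3
    linarith
  rw [Submodule.mem_orthogonal']
  rintro _ ⟨z, rfl⟩
  have h := key _ (Submodule.starProjection_apply_mem _ z)
  rwa [mfderiv_starProjection_horiz] at h

end IsRiemannianMap

end RiemannianMap

/-! ### Traces, and the splitting of `P` on one tangent space. -/

section LinearAlgebra

variable {V : Type*} [NormedAddCommGroup V] [InnerProductSpace ℝ V]

/-- The trace of a bilinear map does not depend on the orthonormal basis. -/
theorem sum_bilin_orthonormalBasis {W : Type*} [AddCommGroup W] [Module ℝ W]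
    (B : V →ₗ[ℝ] V →ₗ[ℝ] W) {ι κ : Type*} [Fintype ι] [Fintype κ]
    (b : OrthonormalBasis ι ℝ V) (c : OrthonormalBasis κ ℝ V) :
    ∑ i, B (b i) (b i) = ∑ j, B (c j) (c j) := by
  classical
  have h : ∀ i, B (b i) (b i)
      = ∑ j, ∑ k, (inner ℝ (c j) (b i) * inner ℝ (c k) (b i)) • B (c j) (c k) := fun i ↦ by
    conv_lhs => rw [← c.sum_repr' (b i)]
    simp only [map_sum, map_smul, LinearMap.sum_apply, LinearMap.smul_apply, Finset.smul_sum,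
      smul_smul]
    rw [Finset.sum_comm]
    exact Finset.sum_congr rfl fun _ _ ↦ Finset.sum_congr rfl fun _ _ ↦ by rw [mul_comm]
  simp only [h]
  rw [Finset.sum_comm]
  refine Finset.sum_congr rfl fun j _ ↦ ?_
  rw [Finset.sum_comm]
  have h2 : ∀ k, ∑ i, (inner ℝ (c j) (b i) * inner ℝ (c k) (b i)) • B (c j) (c k)
      = if k = j then B (c j) (c j) else 0 := fun k ↦ by
    rw [← Finset.sum_smul]
    have : ∑ i, inner ℝ (c j) (b i) * inner ℝ (c k) (b i) = if j = k then (1 : ℝ) else 0 := by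
      rw [← orthonormal_iff_ite.1 c.orthonormal j k, ← b.sum_inner_mul_inner]
      exact Finset.sum_congr rfl fun i _ ↦ by rw [real_inner_comm (b i) (c k)]
    rw [this]
    rcases eq_or_ne k j with rfl | hkj
    · simp
    · simp [hkj, hkj.symm]
  simp [h2]

variable [FiniteDimensional ℝ V]

theorem exists_orthonormalBasis_eq {ι : Type*} [Fintype ι] {e : ι → V} (he : Orthonormal ℝ e)
    (hcard : Fintype.card ι = Module.finrank ℝ V) :
    ∃ b : OrthonormalBasis ι ℝ V, ⇑b = e := by
  refine ⟨OrthonormalBasis.mk he ?_, OrthonormalBasis.coe_mk _ _⟩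
  rw [he.linearIndependent.span_eq_top_of_card_eq_finrank' hcard]

/-- Orthonormal bases of `Kᗮ` and `K` form an orthonormal basis together. -/
theorem exists_orthonormalBasis_sum {K : Submodule ℝ V} {m n : ℕ} {e : Fin m → V} {u : Fin n → V}
    (he : Orthonormal ℝ e) (hu : Orthonormal ℝ u) (heK : ∀ i, e i ∈ Kᗮ) (huK : ∀ i, u i ∈ K)
    (hm : m = Module.finrank ℝ Kᗮ) (hn : n = Module.finrank ℝ K) :
    ∃ b : OrthonormalBasis (Fin m ⊕ Fin n) ℝ V, ⇑b = Sum.elim e u := by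
  have ho : Orthonormal ℝ (Sum.elim e u) := by
    rw [orthonormal_iff_ite] at he hu ⊢
    rintro (i | i) (j | j)
    · simpa using he i j
    · simpa using Submodule.inner_left_of_mem_orthogonal (huK j) (heK i)
    · simpa using Submodule.inner_right_of_mem_orthogonal (huK i) (heK j)
    · simpa using hu i j
  have hcard : Fintype.card (Fin m ⊕ Fin n) = Module.finrank ℝ V := by
    rw [Fintype.card_sum, Fintype.card_fin, Fintype.card_fin, hm, hn, add_comm,
      K.finrank_add_finrank_orthogonal]
  exact exists_orthonormalBasis_eq ho hcard

variable {D₁ D₂ R : Submodule ℝ V} {P : V →L[ℝ] V}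

/-- This is `Pv = φv + ωv`. For `v = a + b` the vectors `Pa ∈ D₁ ≤ R` and `Pb ∈ P(D₂) ≤ Rᗮ` are
orthogonal, so the projections recover them. -/
theorem starProjection_add_starProjection_map (hR : D₁ ⊔ D₂ = R)
    (h₁ : D₁.map P.toLinearMap = D₁) (h₂ : D₂.map P.toLinearMap ≤ Rᗮ) {v : V} (hv : v ∈ R) :
    D₁.starProjection (P v) + (D₂.map P.toLinearMap).starProjection (P v) = P v := by
  rw [← hR] at hv
  obtain ⟨a, ha, b, hb, rfl⟩ := Submodule.mem_sup.1 hv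
  have hPa : P a ∈ D₁ := h₁ ▸ Submodule.mem_map_of_mem (f := P.toLinearMap) ha
  have hPb : P b ∈ D₂.map P.toLinearMap := Submodule.mem_map_of_mem (f := P.toLinearMap) hb
  have hle : D₁ ≤ R := hR ▸ le_sup_left
  have hb1 : P b ∈ D₁ᗮ := Submodule.orthogonal_le hle (h₂ hPb)
  have ha2 : P a ∈ (D₂.map P.toLinearMap)ᗮ :=
    (Submodule.mem_orthogonal' _ _).2 fun w hw ↦
      Submodule.inner_right_of_mem_orthogonal (hle hPa) (h₂ hw)
  simp only [map_add]
  rw [Submodule.starProjection_eq_self_iff.2 hPa, Submodule.starProjection_eq_self_iff.2 hPb,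
    (Submodule.starProjection_apply_eq_zero_iff _).2 hb1,
    (Submodule.starProjection_apply_eq_zero_iff _).2 ha2]
  abel

/-- On the range the normal part of `P` is `ω`, since `φv` lies in `D₁ ≤ R` and `ωv` in `Rᗮ`. -/
theorem starProjection_orthogonal_map (hR : D₁ ⊔ D₂ = R)
    (h₁ : D₁.map P.toLinearMap = D₁) (h₂ : D₂.map P.toLinearMap ≤ Rᗮ) {v : V} (hv : v ∈ R) :
    Rᗮ.starProjection (P v) = (D₂.map P.toLinearMap).starProjection (P v) := by
  have hle : D₁ ≤ R := hR ▸ le_sup_left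
  conv_lhs => rw [← starProjection_add_starProjection_map hR h₁ h₂ hv, map_add]
  rw [Submodule.starProjection_eq_self_iff.2 (h₂ (Submodule.starProjection_apply_mem _ _)),
    (Submodule.starProjection_apply_eq_zero_iff _).2, zero_add]
  rw [Submodule.orthogonal_orthogonal]
  exact hle (Submodule.starProjection_apply_mem _ _)

/-- On normal vectors the normal part of `P` is `C`: for `b ∈ D₂`, `⟪Pw, Pb⟫ = ⟪w, b⟫ = 0`, so the
normal part of `Pw` already lies in `η`. -/
theorem starProjection_orthogonal_of_mem_orthogonal (hle : D₂ ≤ R)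
    (h₂ : D₂.map P.toLinearMap ≤ Rᗮ)
    (hiso : ∀ v w, inner ℝ (P v) (P w) = inner ℝ v w)
    {w : V} (hw : w ∈ Rᗮ) :
    Rᗮ.starProjection (P w) = (Rᗮ ⊓ (D₂.map P.toLinearMap)ᗮ).starProjection (P w) := by
  symm
  refine Submodule.eq_starProjection_of_mem_of_inner_eq_zero ⟨?_, ?_⟩ fun z hz ↦ ?_
  · exact Submodule.starProjection_apply_mem _ _
  · rw [SetLike.mem_coe, Submodule.mem_orthogonal']
    rintro _ ⟨b, hb, rfl⟩
    change inner ℝ _ (P b) = 0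
    have hPb : P b ∈ Rᗮ := h₂ (Submodule.mem_map_of_mem (f := P.toLinearMap) hb)
    rw [Submodule.inner_starProjection_left_eq_right, Submodule.starProjection_eq_self_iff.2 hPb,
      hiso]
    exact Submodule.inner_left_of_mem_orthogonal (hle hb) hw
  · have h := Submodule.sub_starProjection_mem_orthogonal (K := Rᗮ) (P w)
    exact Submodule.inner_left_of_mem_orthogonal hz.1 h

end LinearAlgebra

/-! ### Projection to a smooth subbundle. -/

section Subbundle

variable {EM : Type*} [NormedAddCommGroup EM] [NormedSpace ℝ EM]
  {M : Type*} [TopologicalSpace M] [ChartedSpace EM M]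
  {EN : Type*} [NormedAddCommGroup EN] [NormedSpace ℝ EN] [FiniteDimensional ℝ EN]
  {N : Type*} [TopologicalSpace N] [ChartedSpace EN N] [IsManifold 𝓘(ℝ, EN) ∞ N]
  [RiemannianBundle (fun y : N ↦ TangentSpace 𝓘(ℝ, EN) y)]
  [IsContMDiffRiemannianBundle 𝓘(ℝ, EN) ∞ EN (fun y : N ↦ TangentSpace 𝓘(ℝ, EN) y)]
  {F : M → N} {D : ∀ q : M, Submodule ℝ (TangentSpace 𝓘(ℝ, EN) (F q))} {q : M}

/-- Against a local frame of `D`, the projection has the same inner products as `σ`. This makes `φ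
F_*X` a smooth section, which can be differentiated. -/
theorem IsSmoothSubbundle.smoothAlongAt_starProjection (hD : IsSmoothSubbundle EM F D)
    {σ : ∀ q, TangentSpace 𝓘(ℝ, EN) (F q)} (hσ : SmoothAlongAt EM F σ q) :
    SmoothAlongAt EM F (fun p ↦ (D p).starProjection (σ p)) q := by
  obtain ⟨U, k, ρ, hU, hq, hρ, hs⟩ := hD q
  have hUq : ∀ᶠ p in 𝓝 q, p ∈ U := hU.mem_nhds hq
  have hρs : ∀ i, SmoothAlongAt EM F (ρ i) q := fun i ↦ (hρ i).contMDiffAt (hU.mem_nhds hq)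
  refine SmoothAlongAt.of_inner hσ.contMDiffAt hρs (hUq.mono fun p hp ↦ (hs p hp).1)
    (hUq.mono fun p hp ↦ ?_) fun i ↦ ?_
  · rw [(hs p hp).2]
    exact Submodule.starProjection_apply_mem _ _
  · refine ((hρs i).contMDiffAt_inner hσ).congr_of_eventuallyEq (hUq.mono fun p hp ↦ ?_)
    have hmem : ρ i p ∈ D p := by
      rw [← (hs p hp).2]
      exact Submodule.subset_span ⟨i, rfl⟩
    change inner ℝ (ρ i p) ((D p).starProjection (σ p)) = inner ℝ (ρ i p) (σ p)
    rw [← Submodule.inner_starProjection_left_eq_right,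
      Submodule.starProjection_eq_self_iff.2 hmem]

end Subbundle

/-! ### The harmonicity term and the comparison of traces. -/

section Harmonicity

variable {EM : Type*} [NormedAddCommGroup EM] [NormedSpace ℝ EM] [FiniteDimensional ℝ EM]
  {M : Type*} [TopologicalSpace M] [ChartedSpace EM M] [IsManifold 𝓘(ℝ, EM) ∞ M]
  [RiemannianBundle (fun q : M ↦ TangentSpace 𝓘(ℝ, EM) q)]
  {EN : Type*} [NormedAddCommGroup EN] [NormedSpace ℝ EN] [FiniteDimensional ℝ EN]
  {N : Type*} [TopologicalSpace N] [ChartedSpace EN N] [IsManifold 𝓘(ℝ, EN) ∞ N]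
  [RiemannianBundle (fun y : N ↦ TangentSpace 𝓘(ℝ, EN) y)]
  [IsContMDiffRiemannianBundle 𝓘(ℝ, EN) ∞ EN (fun y : N ↦ TangentSpace 𝓘(ℝ, EN) y)]
  {P : ∀ y : N, TangentSpace 𝓘(ℝ, EN) y →L[ℝ] TangentSpace 𝓘(ℝ, EN) y}
  {F : M → N} {D₁ D₂ : ∀ q : M, Submodule ℝ (TangentSpace 𝓘(ℝ, EN) (F q))} {q : M}

/-- The harmonicity term is the normal part of the second fundamental form. -/
theorem harmonicityTerm_eq_normalPart (hP : IsKahler P) (hF : IsSemiInvariant EM F P D₁ D₂)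
    {X : ∀ q : M, TangentSpace 𝓘(ℝ, EM) q} (hX : SmoothAlongAt EM (fun p : M ↦ p) X q) :
    harmonicityTerm F P D₁ D₂ X q = normalPart EM F q (secondFundamentalForm EN F X X q) := by
  have hσ := hX.push hF.smooth
  have hφ : SmoothAlongAt EM F (phi F P D₁ (push EN F X)) q :=
    hF.subbundle₁.smoothAlongAt_starProjection (hP.smoothAlongAt hσ)
  have hsplit : ∀ p, phi F P D₁ (push EN F X) p + omega F P D₂ (push EN F X) p
      = P (F p) (push EN F X p) := fun p ↦
    starProjection_add_starProjection_map (hF.sup_eq p) (hF.map_eq p) (hF.map_le p)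
      (mfderiv_mem_rangeD _)
  -- Smoothness of `ω F_*X` comes from `P F_*X - φ F_*X`, so only the projection to `D₁` has to be
  -- smooth.
  have hω : SmoothAlongAt EM F (omega F P D₂ (push EN F X)) q :=
    ((hP.smoothAlongAt hσ).sub hφ).congr (.of_forall fun p ↦ by rw [← hsplit p]; abel)
  have h1 : P (F q) (pullbackCov F (push EN F X) q (X q))
      = pullbackCov F (phi F P D₁ (push EN F X)) q (X q)
        + pullbackCov F (omega F P D₂ (push EN F X)) q (X q) := by
    rw [← hP.pullbackCov_map hσ, ← pullbackCov_add hφ hω]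
    exact pullbackCov_congr (.of_forall fun p ↦ (hsplit p).symm) _
  have h2 : pullbackCov F (omega F P D₂ (push EN F X)) q (X q)
      = -shape F (omega F P D₂ (push EN F X)) X q
        + normalCov F X (omega F P D₂ (push EN F X)) q := by
    rw [shape, neg_neg]
    exact ((rangeD EM EN F q).starProjection_add_starProjection_orthogonal _).symm
  -- A second application of `P` turns the left side into `-∇_X F_*X`; then the normal part is
  -- taken.
  have h3 := congrArg (fun v ↦ normalPart EM F q (P (F q) v)) h1
  have hS : shape F (omega F P D₂ (push EN F X)) X q ∈ rangeD EM EN F q :=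
    neg_mem (Submodule.starProjection_apply_mem _ _)
  have hN : normalCov F X (omega F P D₂ (push EN F X)) q ∈ (rangeD EM EN F q)ᗮ :=
    Submodule.starProjection_apply_mem _ _
  have h4 := starProjection_orthogonal_map (hF.sup_eq q) (hF.map_eq q) (hF.map_le q) hS
  have h5 := starProjection_orthogonal_of_mem_orthogonal
    (show D₂ q ≤ rangeD EM EN F q from hF.sup_eq q ▸ le_sup_right) (hF.map_le q)
    (hP.isometry (F q)) hN
  have h6 : normalPart EM F q (mfderiv 𝓘(ℝ, EM) 𝓘(ℝ, EN) F q (leviCivita X q (X q))) = 0 := by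
    refine (Submodule.starProjection_apply_eq_zero_iff _).2 ?_
    rw [Submodule.orthogonal_orthogonal]
    exact mfderiv_mem_rangeD _
  have h6' : normalPart EM F q (secondFundamentalForm EN F X X q)
      = normalPart EM F q (pullbackCov F (push EN F X) q (X q)) := by
    rw [secondFundamentalForm, normalPart, map_sub]
    exact (congrArg _ h6).trans (sub_zero _)
  rw [h6']
  simp only [hP.sq, h2, map_add, map_neg, normalPart] at h3
  rw [h4, h5, ← hP.pullbackCov_map hφ] at h3
  simp only [harmonicityTerm, omega, cPart, eta, imP, normalPart] at h3 ⊢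
  rw [← sub_eq_zero, ← sub_eq_zero.2 h3]
  abel

variable
  [IsContMDiffRiemannianBundle 𝓘(ℝ, EM) ∞ EM (fun q : M ↦ TangentSpace 𝓘(ℝ, EM) q)]

/-- If `ker F_*` is minimal, the trace over `ker F_*` of the second fundamental form of the
Riemannian map `F` vanishes. -/
theorem HasMinimalKer.sum_hessian_eq_zero (hmin : HasMinimalKer EM EN F)
    (hF : IsRiemannianMap EM EN F)
    {u : Fin (Module.finrank ℝ (vert EM EN F q)) → TangentSpace 𝓘(ℝ, EM) q}
    (hu : Orthonormal ℝ u) (hmem : ∀ i, u i ∈ vert EM EN F q) :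
    ∑ i, hessian hF.smooth q (u i) (u i) = 0 := by
  obtain ⟨U, hU, hUv, hUq⟩ := hF.exists_isFrameAt_vert hu hmem
  have hh : ∀ i, hessian hF.smooth q (u i) (u i)
      = -mfderiv 𝓘(ℝ, EM) 𝓘(ℝ, EN) F q
        ((horiz EM EN F q).starProjection (leviCivita (U i) q (U i q))) := fun i ↦ by
    have h := secondFundamentalForm_eq_hessian (X := U i) (Y := U i) hF.smooth (hU.smooth i)
    -- As `F_* U` is identically zero, only `-F_*(∇_U U)` remains, and it depends only on the
    -- horizontal part of `∇_U U`.
    have h0 : push EN F (U i) = fun p ↦ (0 : TangentSpace 𝓘(ℝ, EN) (F p)) := by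
      funext p
      exact mem_vert.1 (hUv i p)
    rw [← hUq i, ← h, secondFundamentalForm, h0, pullbackCov_zero hF.smooth.contMDiffAt, zero_sub,
      mfderiv_starProjection_horiz]
  simp only [hh]
  rw [Finset.sum_neg_distrib, ← map_sum, hmin q U hU, map_zero, neg_zero]

/-- By tensoriality the trace over local frames is that of a bilinear map at the point, the same for
every orthonormal basis. -/
theorem isHarmonic_iff_sum_hessian (hF : ContMDiff 𝓘(ℝ, EM) 𝓘(ℝ, EN) ∞ F) :
    IsHarmonic EM EN F ↔ ∀ q : M, ∑ i,
      hessian hF q (stdOrthonormalBasis ℝ (TangentSpace 𝓘(ℝ, EM) q) i)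
        (stdOrthonormalBasis ℝ (TangentSpace 𝓘(ℝ, EM) q) i) = 0 := by
  have hrank (q : M) : Module.finrank ℝ (⊤ : Submodule ℝ (TangentSpace 𝓘(ℝ, EM) q))
      = Module.finrank ℝ (TangentSpace 𝓘(ℝ, EM) q) := finrank_top ℝ _
  constructor
  · intro h q
    -- `TraceVanishes` indexes frames by the rank of the submodule `⊤`, hence the reindexing.
    let b := (stdOrthonormalBasis ℝ (TangentSpace 𝓘(ℝ, EM) q)).reindex (finCongr (hrank q).symm)
    have hb := h q (fun i p ↦ FiberBundle.extend EM (b i) p)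
      { smooth := fun i ↦ smoothAlongAt_extend q (b i)
        mem := fun i ↦ .of_forall fun p ↦ Submodule.mem_top
        orthonormal := by simpa only [FiberBundle.extend_apply_self] using b.orthonormal }
    rw [← hb, sum_bilin_orthonormalBasis (hessian hF q) _ b]
    rfl
  · intro h q e he
    obtain ⟨b, hb⟩ := exists_orthonormalBasis_eq he.orthonormal
      ((Fintype.card_fin _).trans (hrank q))
    rw [← h q, sum_bilin_orthonormalBasis (hessian hF q) _ b, hb]
    exact Finset.sum_congr rfl fun i _ ↦
      secondFundamentalForm_eq_hessian hF (he.smooth i)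

/-- The trace of the second fundamental form of a Riemannian map with minimal kernel is its trace
over `(ker F_*)^⊥`. -/
theorem HasMinimalKer.sum_hessian_eq (hmin : HasMinimalKer EM EN F)
    (hF : IsRiemannianMap EM EN F)
    {e : Fin (Module.finrank ℝ (horiz EM EN F q)) → TangentSpace 𝓘(ℝ, EM) q}
    (he : Orthonormal ℝ e) (hmem : ∀ i, e i ∈ horiz EM EN F q) :
    ∑ i, hessian hF.smooth q (stdOrthonormalBasis ℝ (TangentSpace 𝓘(ℝ, EM) q) i)
        (stdOrthonormalBasis ℝ (TangentSpace 𝓘(ℝ, EM) q) i)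
      = ∑ i, hessian hF.smooth q (e i) (e i) := by
  let u : Fin (Module.finrank ℝ (vert EM EN F q)) → TangentSpace 𝓘(ℝ, EM) q := fun i ↦
    (stdOrthonormalBasis ℝ (vert EM EN F q) i : TangentSpace 𝓘(ℝ, EM) q)
  have hu : Orthonormal ℝ u :=
    (stdOrthonormalBasis ℝ (vert EM EN F q)).orthonormal.comp_linearIsometry
      (vert EM EN F q).subtypeₗᵢ
  have huv : ∀ i, u i ∈ vert EM EN F q := fun i ↦ Subtype.property _
  obtain ⟨b, hb⟩ := exists_orthonormalBasis_sum he hu hmem huv rfl rfl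
  rw [sum_bilin_orthonormalBasis (hessian hF.smooth q) _ b, hb, Fintype.sum_sum_type]
  simp only [Sum.elim_inl, Sum.elim_inr]
  rw [hmin.sum_hessian_eq_zero hF hu huv, add_zero]

/-- On horizontal vectors the second fundamental form is normal, so taking its normal part changes
nothing. -/
theorem sum_harmonicityTerm_eq (hP : IsKahler P) (hF : IsSemiInvariant EM F P D₁ D₂) {ι : Type*}
    [Fintype ι] {e : ι → ∀ p : M, TangentSpace 𝓘(ℝ, EM) p}
    (he : IsFrameAt (horiz EM EN F) q e) :
    ∑ i, harmonicityTerm F P D₁ D₂ (e i) q = ∑ i, hessian hF.smooth q (e i q) (e i q) := by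
  refine Finset.sum_congr rfl fun i _ ↦ ?_
  have hm : e i q ∈ horiz EM EN F q := (he.mem i).self_of_nhds
  rw [harmonicityTerm_eq_normalPart hP hF (he.smooth i),
    secondFundamentalForm_eq_hessian hF.smooth (he.smooth i)]
  exact Submodule.starProjection_eq_self_iff.2
    (hF.toIsRiemannianMap.hessian_mem_orthogonal hm hm)

end Harmonicity

end ClairautMap

/-! ### The harmonicity criterion. -/

theorem mainTheorem2
    {EM : Type*} [NormedAddCommGroup EM] [NormedSpace ℝ EM] [FiniteDimensional ℝ EM]
    {M : Type*} [TopologicalSpace M] [T2Space M] [SecondCountableTopology M]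
    [ChartedSpace EM M] [IsManifold 𝓘(ℝ, EM) ∞ M]
    [RiemannianBundle (fun q : M ↦ TangentSpace 𝓘(ℝ, EM) q)]
    [IsContMDiffRiemannianBundle 𝓘(ℝ, EM) ∞ EM (fun q : M ↦ TangentSpace 𝓘(ℝ, EM) q)]
    {EN : Type*} [NormedAddCommGroup EN] [NormedSpace ℝ EN] [FiniteDimensional ℝ EN]
    {N : Type*} [TopologicalSpace N] [T2Space N] [SecondCountableTopology N]
    [ChartedSpace EN N] [IsManifold 𝓘(ℝ, EN) ∞ N]
    [RiemannianBundle (fun y : N ↦ TangentSpace 𝓘(ℝ, EN) y)]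
    [IsContMDiffRiemannianBundle 𝓘(ℝ, EN) ∞ EN (fun y : N ↦ TangentSpace 𝓘(ℝ, EN) y)]
    (P : ∀ y : N, TangentSpace 𝓘(ℝ, EN) y →L[ℝ] TangentSpace 𝓘(ℝ, EN) y)
    (hP : ClairautMap.IsKahler P)
    (F : M → N) (D₁ D₂ : ∀ q : M, Submodule ℝ (TangentSpace 𝓘(ℝ, EN) (F q))) (f : N → ℝ)
    (hF : ClairautMap.IsCSIRM EM F P D₁ D₂ f)
    (hmin : ClairautMap.HasMinimalKer EM EN F) :
    ClairautMap.IsHarmonic EM EN F ↔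
      ClairautMap.TraceVanishes (ClairautMap.horiz EM EN F)
        (ClairautMap.harmonicityTerm F P D₁ D₂) := by
  have hR := hF.toIsRiemannianMap
  rw [ClairautMap.isHarmonic_iff_sum_hessian hR.smooth]
  constructor
  · intro h q e he
    rw [ClairautMap.sum_harmonicityTerm_eq hP hF.toIsSemiInvariant he,
      ← hmin.sum_hessian_eq hR he.orthonormal fun i ↦ (he.mem i).self_of_nhds]
    exact h q
  · intro h q
    have he : Orthonormal ℝ fun i ↦
        (stdOrthonormalBasis ℝ (ClairautMap.horiz EM EN F q) i : TangentSpace 𝓘(ℝ, EM) q) :=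
      (stdOrthonormalBasis ℝ (ClairautMap.horiz EM EN F q)).orthonormal.comp_linearIsometry
        (ClairautMap.horiz EM EN F q).subtypeₗᵢ
    -- The hypothesis speaks only of smooth horizontal frames, so an orthonormal basis at `q` is
    -- first extended to one.
    obtain ⟨X, hX, hXq⟩ := hR.exists_isFrameAt_horiz he fun i ↦ Subtype.property _
    rw [hmin.sum_hessian_eq hR hX.orthonormal fun i ↦ (hX.mem i).self_of_nhds,
      ← ClairautMap.sum_harmonicityTerm_eq hP hF.toIsSemiInvariant hX]
    exact h q X hX
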